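/- For a permutation $\sigma=\sigma_1\sigma_2\cdots\sigma_n$ of $[n]=\{1,\dots,n\}$, a descent is an index $i$, $1\le i<n$, with $\sigma_i>\sigma_{i+1}$. Let $\mathrm{des}(\sigma)$ be the number of descents of $\sigma$, $\mathrm{maj}(\sigma)$ the sum of the descents of $\sigma$, and $\mathrm{ides}(\sigma)=\mathrm{des}(\sigma^{-1})$. Call a word with distinct integer letters an André I (resp. André II) permutation if it is empty or has a single letter, or if, writing it as $\tau\, m\, \tau'$ with $m$ its smallest letter, both $\tau$ and $\tau'$ are André I (resp. André II) permutations and the largest (resp. smallest) letter of $\tau\tau'$ lies in $\tau'$. Let $\mathrm{And}^{I}_n$ and $\mathrm{And}^{II}_n$ be the sets of André I and André II permutations of $[n]$. Let $RS_n$ be the set of simsun permutations of $[n]$, i.e. the permutations $\sigma=\sigma_1\cdots\sigma_n$ of $[n]$ with $\sigma_n=n$ (no condition if $n=0$) such that, for every $0\le k\le n$, the subword of $\sigma$ formed by the letters $1,\dots,k$ has no double descent, i.e. no three consecutive letters $a>b>c$. **Theorem.** For every $n\ge 0$, the trivariate statistic $(\mathrm{ides},\mathrm{des},\mathrm{maj})$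 is equidistributed over $\mathrm{And}^{I}_n$, $\mathrm{And}^{II}_n$ and $RS_n$, i.e., as polynomials in $s,t,q$, $$\sum_{\sigma\in \mathrm{And}^{I}_n} s^{\mathrm{ides}(\sigma)}t^{\mathrm{des}(\sigma)}q^{\mathrm{maj}(\sigma)}=\sum_{\sigma\in \mathrm{And}^{II}_n} s^{\mathrm{ides}(\sigma)}t^{\mathrm{des}(\sigma)}q^{\mathrm{maj}(\sigma)}=\sum_{\sigma\in RS_n} s^{\mathrm{ides}(\sigma)}t^{\mathrm{des}(\sigma)}q^{\mathrm{maj}(\sigma)}.$$ In particular, $$\sum_{\sigma\in \mathrm{And}^{I}_n} s^{\mathrm{ides}(\sigma)}=\sum_{\sigma\in \mathrm{And}^{II}_n} s^{\mathrm{ides}(\sigma)}=\sum_{\sigma\in RS_n} s^{\mathrm{ides}(\sigma)}.$$ -/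

import Mathlib

/-- The word `σ_1 σ_2 ⋯ σ_n` on the letters `1, …, n` of a permutation of an `n`-element set. -/
def permWord {n : ℕ} (σ : Equiv.Perm (Fin n)) : List ℕ :=
  List.ofFn fun i => (σ i : ℕ) + 1

/-- The set of descents of a word `w_1 ⋯ w_n`: the indices `1 ≤ i < n` with `w_i > w_{i+1}`.
The letter `w_i` is `w.getD (i - 1) 0`, lists being indexed from `0`; the default value `0` is
never used. -/
def descentSet (w : List ℕ) : Finset ℕ :=
  {i ∈ Finset.Ico 1 w.length | w.getD (i - 1) 0 > w.getD i 0}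

/-- The number of descents of a permutation. -/
def des {n : ℕ} (σ : Equiv.Perm (Fin n)) : ℕ := (descentSet (permWord σ)).card

/-- The number of inverse descents of a permutation. -/
def ides {n : ℕ} (σ : Equiv.Perm (Fin n)) : ℕ := des σ⁻¹

/-- The major index of a permutation: the sum of its descents. -/
def maj {n : ℕ} (σ : Equiv.Perm (Fin n)) : ℕ := ∑ i ∈ descentSet (permWord σ), i

/-- André I words (sequences of distinct letters): the empty word, the one-letter words, and the
words `τ m τ'` of length at least two, with `m` the least letter, such that `τ` and `τ'` are
André I words and the greatest letter of `τ τ'` lies in `τ'`. -/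
inductive IsAndreI : List ℕ → Prop
  | nil : IsAndreI []
  | singleton (a : ℕ) : IsAndreI [a]
  | node (l : List ℕ) (m : ℕ) (r : List ℕ) (nodup : (l ++ m :: r).Nodup)
      (hmin : ∀ x ∈ l ++ r, m < x) (hl : IsAndreI l) (hr : IsAndreI r)
      (hmax : ∃ M ∈ r, ∀ x ∈ l ++ r, x ≤ M) : IsAndreI (l ++ m :: r)

/-- André II words: as for André I words, with the requirement that the least letter (instead
of the greatest letter) of `τ τ'` lies in `τ'`. -/
inductive IsAndreII : List ℕ → Prop
  | nil : IsAndreII []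
  | singleton (a : ℕ) : IsAndreII [a]
  | node (l : List ℕ) (m : ℕ) (r : List ℕ) (nodup : (l ++ m :: r).Nodup)
      (hmin : ∀ x ∈ l ++ r, m < x) (hl : IsAndreII l) (hr : IsAndreII r)
      (hmin2 : ∃ k ∈ r, ∀ x ∈ l ++ r, k ≤ x) : IsAndreII (l ++ m :: r)

/-- The word has no double descent, that is, no index `i` with `w_i > w_{i+1} > w_{i+2}`. -/
def NoDoubleDescent (w : List ℕ) : Prop :=
  ∀ i, i + 2 < w.length →
    ¬ (w.getD i 0 > w.getD (i + 1) 0 ∧ w.getD (i + 1) 0 > w.getD (i + 2) 0)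

/-- Simsun permutations: the last letter is `n` (no condition if `n = 0`), and for every `k`
there is no double descent in the word that is left when the letters `n, n - 1, …, k + 1` have
been removed. -/
def IsSimsun {n : ℕ} (σ : Equiv.Perm (Fin n)) : Prop :=
  (∀ h : permWord σ ≠ [], (permWord σ).getLast h = n) ∧
    ∀ k ≤ n, NoDoubleDescent ((permWord σ).filter (· ≤ k))

open Classical in
/-- The set of `n`-André I permutations. -/
noncomputable def andreI (n : ℕ) : Finset (Equiv.Perm (Fin n)) :=
  {σ | IsAndreI (permWord σ)}

open Classical in
/-- The set of `n`-André II permutations. -/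
noncomputable def andreII (n : ℕ) : Finset (Equiv.Perm (Fin n)) :=
  {σ | IsAndreII (permWord σ)}

open Classical in
/-- The set of `n`-simsun permutations. -/
noncomputable def simsun (n : ℕ) : Finset (Equiv.Perm (Fin n)) :=
  {σ | IsSimsun σ}

/-- The generating function `∑ s^ides t^des q^maj` of a set of permutations, a polynomial in the
three variables `s = X 0`, `t = X 1`, `q = X 2`. -/
noncomputable def genFun {n : ℕ} (S : Finset (Equiv.Perm (Fin n))) : MvPolynomial (Fin 3) ℤ :=
  ∑ σ ∈ S, MvPolynomial.X 0 ^ ides σ * MvPolynomial.X 1 ^ des σ * MvPolynomial.X 2 ^ maj σ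

/-- The inverse-descent polynomial `∑ s^ides` of a set of permutations. -/
noncomputable def idesPoly {n : ℕ} (S : Finset (Equiv.Perm (Fin n))) : Polynomial ℤ :=
  ∑ σ ∈ S, Polynomial.X ^ ides σ

/-! Permutations are replaced by words with repeated letters. A word over {0, …, k-1} has a
standardization σ, in which equal letters are made to increase from left to right. It has the same
descent set, and with the right conventions for ties the word lies in a family exactly when σ does.
The words with a given σ correspond to the weakly increasing sequences with values below k - ides σ
(`card_sort_eq`); their number is 0 for k ≤ ides σ and 1 for k = ides σ + 1. By this triangularity,
the descent sets of the words of a family, summed for each k, determine the joint distribution of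
ides and the descent set (`sum_fnWord_eq`, `sum_filter_ides_eq`), hence that of (ides, des, maj).

Descents are recorded by noncommuting weights: b for a letter that completes a descent, a for any
other. Let T_k be the weight sum of the nonempty words of a family with letters below k. All three
families give T_k = (S_1 + ⋯ + S_k) a, where S_k is `insertionSeries k a (a * b)`. For André words,
cutting at the leftmost least letter shows that the increments X_k = T_k - T_{k-1} satisfy X_{k+1} =
X_k + (a + T_k b) X_{k+1}, with a in place of X_0. In type I, X_k collects the words that contain
the letter k-1, in type II those that contain 0 (`wordSum_maxRight`, `wordSum_minRight`). For simsun
words, inserting copies of a new greatest letter acts as a substitution on the weights of descents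
and of the remaining letters, and iterating it produces S_k (`finsum_insertions`,
`finsum_simsunWords`). The link is `insertionSeries_rec`.

For a and b one takes matrices supported on the first superdiagonal, so that long words have weight
zero and all sums are finite. A corner entry of the word sum isolates one length and displays the
descent sets (`wordSum_superdiagonal`). -/

/-! ### Sums over sets with finite support -/

open Function in
/-- A finite sum over a set may be computed along the fibres of a map. -/
theorem finsum_mem_fiberwise {α β M : Type*} [AddCommMonoid M] {s : Set α} {t : Set β}
    (f : α → M) (g : α → β) (hs : (s ∩ support f).Finite) (hg : ∀ x ∈ s, g x ∈ t) :
    ∑ᶠ x ∈ s, f x = ∑ᶠ y ∈ t, ∑ᶠ x ∈ {x | x ∈ s ∧ g x = y}, f x := by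
  classical
  have hin : ∀ y, ∑ᶠ x ∈ {x | x ∈ s ∧ g x = y}, f x = ∑ x ∈ hs.toFinset with g x = y, f x := by
    intro y
    apply finsum_mem_eq_sum_of_inter_support_eq
    ext x
    simp only [Set.mem_inter_iff, Set.mem_ofPred_eq, mem_support, Finset.coe_filter,
      Set.Finite.mem_toFinset]
    tauto
  simp only [hin]
  rw [finsum_mem_eq_sum _ hs,
    ← Finset.sum_fiberwise_of_maps_to (t := hs.toFinset.image g) (g := g)
      (fun x hx => Finset.mem_image_of_mem g hx)]
  symm
  apply finsum_mem_eq_sum_of_inter_support_eq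
  ext y
  simp only [Set.mem_inter_iff, mem_support, Finset.coe_image, Set.mem_image]
  constructor
  · rintro ⟨_, hy⟩
    obtain ⟨x, hx, _⟩ := Finset.exists_ne_zero_of_sum_ne_zero hy
    rw [Finset.mem_filter] at hx
    exact ⟨⟨x, hx.1, hx.2⟩, hy⟩
  · rintro ⟨⟨x, hx, rfl⟩, hy⟩
    exact ⟨hg x (by simpa using And.left (by simpa using hx : x ∈ s ∧ f x ≠ 0)), hy⟩

open Function in
theorem mul_finsum_mem_of_finite {α R : Type*} [Ring R] {s : Set α} (f : α → R) (r : R)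
    (hs : (s ∩ support f).Finite) : ∑ᶠ x ∈ s, r * f x = r * ∑ᶠ x ∈ s, f x :=
  ((AddMonoidHom.mulLeft r).map_finsum_mem' hs).symm

open Function in
theorem finsum_mem_mul_of_finite {α R : Type*} [Ring R] {s : Set α} (f : α → R) (r : R)
    (hs : (s ∩ support f).Finite) : ∑ᶠ x ∈ s, f x * r = (∑ᶠ x ∈ s, f x) * r :=
  ((AddMonoidHom.mulRight r).map_finsum_mem' hs).symm

open Function in
theorem finsum_mem_prod_mul {α β R : Type*} [Ring R] {s : Set α} {t : Set β} (f : α → R)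
    (g : β → R) (hs : (s ∩ support f).Finite) (ht : (t ∩ support g).Finite) :
    ∑ᶠ p ∈ s ×ˢ t, f p.1 * g p.2 = (∑ᶠ x ∈ s, f x) * ∑ᶠ y ∈ t, g y := by
  classical
  rw [finsum_mem_eq_sum _ hs, finsum_mem_eq_sum _ ht, Finset.sum_mul_sum, ← Finset.sum_product']
  apply finsum_mem_eq_sum_of_inter_support_eq
  ext ⟨x, y⟩
  simp only [Set.mem_inter_iff, mem_support, Finset.coe_product, Set.mem_prod,
    Set.Finite.coe_toFinset]
  constructor
  · rintro ⟨⟨hx, hy⟩, h⟩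
    exact ⟨⟨⟨hx, left_ne_zero_of_mul h⟩, hy, right_ne_zero_of_mul h⟩, h⟩
  · rintro ⟨⟨⟨hx, _⟩, hy, _⟩, h⟩
    exact ⟨⟨hx, hy⟩, h⟩

/-! ### Nilpotent filtrations -/

/-- A decreasing multiplicative filtration of a ring which reaches zero. -/
structure NilFiltration (B : Type*) [Ring B] where
  /-- The subgroups of the filtration. -/
  J : ℕ → AddSubgroup B
  mem_zero : ∀ x, x ∈ J 0
  mul_mem : ∀ {m n x y}, x ∈ J m → y ∈ J n → x * y ∈ J (m + n)
  anti : Antitone J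
  /-- An index at which the filtration vanishes. -/
  len : ℕ
  eq_zero : ∀ x ∈ J len, x = 0

namespace NilFiltration

variable {B : Type*} [Ring B] (F : NilFiltration B)

theorem mul_mem_left (x : B) {y : B} {n : ℕ} (hy : y ∈ F.J n) : x * y ∈ F.J n := by
  simpa using F.mul_mem (F.mem_zero x) hy

theorem pow_mem {x : B} (hx : x ∈ F.J 1) (n : ℕ) : x ^ n ∈ F.J n := by
  induction n with
  | zero => exact F.mem_zero _
  | succ n ih => rw [pow_succ]; exact F.mul_mem ih hx

theorem isUnit_one_sub {x : B} (hx : x ∈ F.J 1) : IsUnit (1 - x) :=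
  IsNilpotent.isUnit_one_sub ⟨F.len, F.eq_zero _ (F.pow_mem hx _)⟩

end NilFiltration

/-! ### The insertion series and its recursion -/

/-- The geometric series `∑ c ^ n`, when it makes sense. -/
noncomputable def geomInv {B : Type*} [Ring B] (c : B) : B := Ring.inverse (1 - c)

/-- The series obtained from `1` by `k` times replacing `c` by `c + (∑ c ^ n) * d` and `d` by
`(∑ c ^ n) * d`, followed by a multiplication by `∑ c ^ n`. -/
noncomputable def insertionSeries {B : Type*} [Ring B] : ℕ → B → B → B
  | 0, _, _ => 1
  | k + 1, c, d => insertionSeries k (c + geomInv c * d) (geomInv c * d) * geomInv c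

section

variable {B : Type*} [Ring B]

theorem mul_geomInv (F : NilFiltration B) {c : B} (hc : c ∈ F.J 1) : (1 - c) * geomInv c = 1 :=
  Ring.mul_inverse_cancel _ (F.isUnit_one_sub hc)

theorem insertionSeries_one (c d : B) : insertionSeries 1 c d = geomInv c := by
  simp [insertionSeries]

/-- Put g = `geomInv c`. Apply the induction hypothesis to (c + g d, g d) and multiply by g on the
right: every series of index i there becomes the series of index i + 1 in (c, d), and the extra
summand g d of the new c supplies the missing first term of the sum. -/
theorem insertionSeries_rec (F : NilFiltration B) (k : ℕ) (c d : B) (hc : c ∈ F.J 1)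
    (hd : d ∈ F.J 2) :
    (1 - c - (∑ i ∈ Finset.range k, insertionSeries (i + 1) c d) * d) *
      insertionSeries (k + 1) c d = insertionSeries k c d := by
  induction k generalizing c d with
  | zero => simp [insertionSeries, mul_geomInv F hc]
  | succ k ih =>
    have hd' : geomInv c * d ∈ F.J 2 := F.mul_mem_left _ hd
    have hc' : c + geomInv c * d ∈ F.J 1 := add_mem hc (F.anti one_le_two hd')
    have h := congrArg (· * geomInv c) (ih _ _ hc' hd')
    simp only [mul_assoc] at h
    change _ * insertionSeries (k + 2) c d = insertionSeries (k + 1) c d at h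
    rw [← h, Finset.sum_range_succ', insertionSeries_one]
    congr 1
    have e : (∑ i ∈ Finset.range k, insertionSeries (i + 1) (c + geomInv c * d) (geomInv c * d)) *
        (geomInv c * d) = (∑ i ∈ Finset.range k, insertionSeries (i + 1 + 1) c d) * d := by
      rw [← mul_assoc, Finset.sum_mul]
      rfl
    rw [e]
    noncomm_ring

/-- The recursion which characterises the generating functions of the three families. -/
theorem eq_insertionSeries_of_rec (F : NilFiltration B) (a b : B) (ha : a ∈ F.J 1)
    (hb : b ∈ F.J 1) (X T : ℕ → B)
    (hT0 : T 0 = 0) (hT : ∀ k, T (k + 1) = T k + X (k + 1))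
    (hX0 : X 1 = a + (a + T 0 * b) * X 1)
    (hX : ∀ k, X (k + 2) = X (k + 1) + (a + T (k + 1) * b) * X (k + 2)) (k : ℕ) :
    T k = (∑ i ∈ Finset.range k, insertionSeries (i + 1) a (a * b)) * a := by
  -- Since 1 - a - T_k b is a unit, the recursion has only one solution. The conditional treats the
  -- start, where a = S_0 a plays the part of X_0.
  have key : ∀ k, T k = (∑ i ∈ Finset.range k, insertionSeries (i + 1) a (a * b)) * a →
      X (k + 1) = (if k = 0 then a else X k) + (a + T k * b) * X (k + 1) →
      (if k = 0 then a else X k) = insertionSeries k a (a * b) * a →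
      X (k + 1) = insertionSeries (k + 1) a (a * b) * a := by
    intro k h1 h2 h3
    have hu := F.isUnit_one_sub (add_mem ha (F.mul_mem_left (T k) hb))
    apply hu.mul_left_cancel
    rw [sub_mul, one_mul, sub_eq_iff_eq_add.2 h2, h3,
      ← insertionSeries_rec F k a (a * b) ha (F.mul_mem ha hb), h1]
    noncomm_ring
  have main : ∀ k, T k = (∑ i ∈ Finset.range k, insertionSeries (i + 1) a (a * b)) * a ∧
      X (k + 1) = insertionSeries (k + 1) a (a * b) * a := by
    intro k
    induction k with
    | zero =>
      have : T 0 = (∑ i ∈ Finset.range 0, insertionSeries (i + 1) a (a * b)) * a := by simp [hT0]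
      exact ⟨this, key 0 this (by simpa using hX0) (by simp [insertionSeries])⟩
    | succ k ih =>
      have : T (k + 1) =
          (∑ i ∈ Finset.range (k + 1), insertionSeries (i + 1) a (a * b)) * a := by
        rw [hT, ih.1, ih.2, Finset.sum_range_succ, add_mul]
      exact ⟨this, key (k + 1) this (by simpa using hX k) (by simpa using ih.2)⟩
  exact (main k).1

end

/-! ### Weights that record descents -/

/-- The product of the weights of the successive letters of a word which is read after the letter
`p`: the weight is `b` for a letter that completes a descent, and `a` otherwise. -/
def stepWeight {B : Type*} [Ring B] (a b : B) : ℕ → List ℕ → B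
  | _, [] => 1
  | p, x :: v => (if x < p then b else a) * stepWeight a b x v

theorem stepWeight_congr {B : Type*} [Ring B] (a b : B) {p q : ℕ} {v : List ℕ}
    (hp : ∀ x ∈ v, p ≤ x) (hq : ∀ x ∈ v, q ≤ x) : stepWeight a b p v = stepWeight a b q v := by
  cases v with
  | nil => rfl
  | cons x v => simp_all [stepWeight, not_lt.2]

theorem stepWeight_append {B : Type*} [Ring B] (a b : B) (p : ℕ) (u v : List ℕ) :
    stepWeight a b p (u ++ v) = stepWeight a b p u * stepWeight a b (u.getLastD p) v := by
  induction u generalizing p with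
  | nil => simp [stepWeight]
  | cons x u ih => rw [List.cons_append, stepWeight, stepWeight, ih, mul_assoc, List.getLastD_cons]

theorem stepWeight_map_succ {B : Type*} [Ring B] (a b : B) (p : ℕ) (v : List ℕ) :
    stepWeight a b (p + 1) (v.map (· + 1)) = stepWeight a b p v := by
  induction v generalizing p with
  | nil => rfl
  | cons x v ih => simp [stepWeight, ih]

theorem stepWeight_zero_map_succ {B : Type*} [Ring B] (a b : B) (v : List ℕ) :
    stepWeight a b 0 (v.map (· + 1)) = stepWeight a b 0 v := by
  rw [← stepWeight_map_succ a b 0 v]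
  exact stepWeight_congr a b (by simp) (by simp)

/-- The letter m completes a descent from the last letter of u. No letter of v is below m, so v is
weighed as if it were read from the start. -/
theorem stepWeight_append_cons {B : Type*} [Ring B] (a b : B) {u v : List ℕ} {m : ℕ}
    (hu : u ≠ []) (hm : ∀ x ∈ u, m < x) (hv : ∀ x ∈ v, m ≤ x) :
    stepWeight a b 0 (u ++ m :: v) = stepWeight a b 0 u * b * stepWeight a b 0 v := by
  have : m < u.getLastD 0 := by
    rw [List.getLastD_eq_getLast?, List.getLast?_eq_getLast_of_ne_nil hu]
    exact hm _ (List.getLast_mem hu)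
  rw [stepWeight_append, stepWeight, if_pos this, mul_assoc,
    stepWeight_congr a b hv (fun _ _ => Nat.zero_le _)]

theorem stepWeight_cons {B : Type*} [Ring B] (a b : B) {v : List ℕ} {m : ℕ}
    (hv : ∀ x ∈ v, m ≤ x) : stepWeight a b 0 (m :: v) = a * stepWeight a b 0 v := by
  rw [stepWeight, if_neg (Nat.not_lt_zero _), stepWeight_congr a b hv (fun _ _ => Nat.zero_le _)]

section

variable {B : Type*} [Ring B] (F : NilFiltration B)

theorem stepWeight_mem {a b : B} (ha : a ∈ F.J 1) (hb : b ∈ F.J 1) (p : ℕ) (v : List ℕ) :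
    stepWeight a b p v ∈ F.J v.length := by
  induction v generalizing p with
  | nil => exact F.mem_zero _
  | cons x v ih =>
    rw [stepWeight, List.length_cons, add_comm]
    refine F.mul_mem ?_ (ih _)
    split_ifs <;> assumption

theorem finite_words (k n : ℕ) : {w : List ℕ | (∀ x ∈ w, x < k) ∧ w.length < n}.Finite := by
  refine ((List.finite_length_lt (Fin k) n).image (List.map Fin.val)).subset ?_
  rintro w ⟨h1, h2⟩
  exact ⟨w.pmap Fin.mk h1, by simpa using h2, by simp [List.map_pmap]⟩

open Function in
-- Words of length at least `F.len` have weight zero, and only finitely many shorter words have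
-- bounded letters.
theorem NilFiltration.finite_inter_support (F : NilFiltration B) {f : List ℕ → B}
    (hf : ∀ w, f w ∈ F.J w.length) {L : Set (List ℕ)} {k : ℕ} (hL : ∀ w ∈ L, ∀ x ∈ w, x < k) :
    (L ∩ support f).Finite := by
  refine (finite_words k F.len).subset ?_
  rintro w ⟨h1, h2⟩
  refine ⟨hL w h1, ?_⟩
  by_contra h
  exact h2 (F.eq_zero _ (F.anti (not_lt.1 h) (hf w)))

end

/-! ### André words with repeated letters -/

/-- Words which are empty, or of the form `l m r` with `m` their least letter, leftmost among the
least letters, such that `l` and `r` are again of this form and either are both empty or satisfy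
`Q l r`. -/
inductive IsNodeWord (Q : List ℕ → List ℕ → Prop) : List ℕ → Prop
  | nil : IsNodeWord Q []
  | singleton (a : ℕ) : IsNodeWord Q [a]
  | node (l : List ℕ) (m : ℕ) (r : List ℕ) (hl' : ∀ x ∈ l, m < x) (hr' : ∀ x ∈ r, m ≤ x)
      (hl : IsNodeWord Q l) (hr : IsNodeWord Q r) (hQ : Q l r) : IsNodeWord Q (l ++ m :: r)

theorem append_cons_inj_of_min {l l' r r' : List ℕ} {m m' : ℕ} (h : l ++ m :: r = l' ++ m' :: r')
    (h1 : ∀ x ∈ l, m < x) (h2 : ∀ x ∈ r, m ≤ x) (h1' : ∀ x ∈ l', m' < x)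
    (h2' : ∀ x ∈ r', m' ≤ x) : l = l' ∧ m = m' ∧ r = r' := by
  have hm : m' ∈ l ++ m :: r := by simp [h]
  have hm' : m ∈ l' ++ m' :: r' := by simp [← h]
  have e : m = m' := by
    simp only [List.mem_append, List.mem_cons] at hm hm'
    apply le_antisymm
    · rcases hm with hm | hm | hm
      exacts [(h1 _ hm).le, hm.ge, h2 _ hm]
    · rcases hm' with hm | hm | hm
      exacts [(h1' _ hm).le, hm.ge, h2' _ hm]
  subst e
  have hl : m ∉ l := fun h => (h1 _ h).false
  have hl' : m ∉ l' := fun h => (h1' _ h).false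
  clear h1 h2 h1' h2' hm hm'
  induction l generalizing l' with
  | nil =>
    cases l' with
    | nil => simpa using h
    | cons y l' =>
      simp only [List.nil_append, List.cons_append, List.cons.injEq] at h
      simp [h.1] at hl'
  | cons x l ih =>
    cases l' with
    | nil =>
      simp only [List.nil_append, List.cons_append, List.cons.injEq] at h
      simp [h.1] at hl
    | cons y l' =>
      simp only [List.cons_append, List.cons.injEq] at h
      simp only [List.mem_cons, not_or] at hl hl'
      have := ih h.2 hl.2 hl'.2
      simp [h.1, this]

theorem isNodeWord_append_cons_iff {Q : List ℕ → List ℕ → Prop} {l r : List ℕ} {m : ℕ}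
    (h1 : ∀ x ∈ l, m < x) (h2 : ∀ x ∈ r, m ≤ x) : IsNodeWord Q (l ++ m :: r) ↔
      (l = [] ∧ r = []) ∨ (IsNodeWord Q l ∧ IsNodeWord Q r ∧ Q l r) := by
  constructor
  · intro h
    generalize hw : l ++ m :: r = w at h
    cases h with
    | nil => simp at hw
    | singleton a =>
      obtain ⟨rfl, rfl, rfl⟩ := append_cons_inj_of_min (l' := []) (r' := []) (m' := a) hw h1 h2
        (by simp) (by simp)
      simp
    | node l' m' r' h1' h2' hl hr hQ =>
      obtain ⟨rfl, rfl, rfl⟩ := append_cons_inj_of_min hw h1 h2 h1' h2'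
      exact Or.inr ⟨hl, hr, hQ⟩
  · rintro (⟨rfl, rfl⟩ | ⟨hl, hr, hQ⟩)
    exacts [.singleton m, .node l m r h1 h2 hl hr hQ]

/-- The pairs couple two words of the same order pattern, where of two equal letters the left one
counts as smaller. That is why the minimum is strict against the left part and weak against the
right part. -/
theorem IsNodeWord.map_snd {Q : List ℕ → List ℕ → Prop}
    (hQ : ∀ l r : List (ℕ × ℕ), (∀ p ∈ l, ∀ q ∈ r, p.1 ≤ q.1 ↔ p.2 ≤ q.2) →
      Q (l.map Prod.fst) (r.map Prod.fst) → Q (l.map Prod.snd) (r.map Prod.snd))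
    {p : List (ℕ × ℕ)} (hp : p.Pairwise fun x y => x.1 ≤ y.1 ↔ x.2 ≤ y.2)
    (h : IsNodeWord Q (p.map Prod.fst)) : IsNodeWord Q (p.map Prod.snd) := by
  generalize hw : p.map Prod.fst = w at h
  induction h generalizing p with
  | nil => rw [List.map_eq_nil_iff.1 hw]; exact .nil
  | singleton a =>
    obtain ⟨x, rfl, rfl⟩ := List.map_eq_singleton_iff.1 hw
    exact .singleton _
  | node l m r h1 h2 hl hr h3 ihl ihr =>
    obtain ⟨l, s, rfl, rfl, hs⟩ := List.map_eq_append_iff.1 hw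
    obtain ⟨m, r, rfl, rfl, rfl⟩ := List.map_eq_cons_iff.1 hs
    rw [List.pairwise_append, List.pairwise_cons] at hp
    obtain ⟨hpl, ⟨hpm, hpr⟩, hplr⟩ := hp
    rw [List.map_append, List.map_cons]
    refine .node _ _ _ ?_ ?_ (ihl hpl rfl) (ihr hpr rfl)
      (hQ _ _ (fun x hx y hy => hplr x hx y (by simp [hy])) h3)
    · simp only [List.forall_mem_map] at h1 ⊢
      intro x hx
      rw [← not_le, ← hplr x hx m (by simp), not_le]
      exact h1 x hx
    · simp only [List.forall_mem_map] at h2 ⊢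
      exact fun x hx => (hpm x hx).1 (h2 x hx)

theorem IsNodeWord.map_snd_iff {Q : List ℕ → List ℕ → Prop}
    (hQ : ∀ l r : List (ℕ × ℕ), (∀ p ∈ l, ∀ q ∈ r, p.1 ≤ q.1 ↔ p.2 ≤ q.2) →
      Q (l.map Prod.fst) (r.map Prod.fst) → Q (l.map Prod.snd) (r.map Prod.snd))
    (p : List (ℕ × ℕ)) (hp : p.Pairwise fun x y => x.1 ≤ y.1 ↔ x.2 ≤ y.2) :
    IsNodeWord Q (p.map Prod.fst) ↔ IsNodeWord Q (p.map Prod.snd) := by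
  refine ⟨IsNodeWord.map_snd hQ hp, fun h => ?_⟩
  have := IsNodeWord.map_snd hQ (p := p.map Prod.swap)
    (List.pairwise_map.2 (hp.imp fun h => h.symm))
  rw [List.map_map, List.map_map] at this
  exact this h

/-- Some letter of `r` is at least as large as all letters of `l`. -/
def MaxRight (l r : List ℕ) : Prop := r ≠ [] ∧ ∀ x ∈ l, ∃ y ∈ r, x ≤ y

/-- Some letter of `r` is smaller than all letters of `l`. -/
def MinRight (l r : List ℕ) : Prop := r ≠ [] ∧ ∀ x ∈ l, ∃ y ∈ r, y < x

/-- Only comparisons x ≤ y with x to the left of y are preserved. This dictates the weak inequality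
in `MaxRight` and its negation, a strict one, in `MinRight`. -/
theorem maxRight_map (l r : List (ℕ × ℕ)) (h : ∀ p ∈ l, ∀ q ∈ r, p.1 ≤ q.1 ↔ p.2 ≤ q.2)
    (hQ : MaxRight (l.map Prod.fst) (r.map Prod.fst)) :
    MaxRight (l.map Prod.snd) (r.map Prod.snd) := by
  refine ⟨by simpa using hQ.1, ?_⟩
  simp only [List.forall_mem_map]
  intro x hx
  obtain ⟨y, hy, hxy⟩ := hQ.2 _ (List.mem_map_of_mem hx)
  obtain ⟨q, hq, rfl⟩ := List.mem_map.1 hy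
  exact ⟨q.2, List.mem_map_of_mem hq, (h x hx q hq).1 hxy⟩

theorem minRight_map (l r : List (ℕ × ℕ)) (h : ∀ p ∈ l, ∀ q ∈ r, p.1 ≤ q.1 ↔ p.2 ≤ q.2)
    (hQ : MinRight (l.map Prod.fst) (r.map Prod.fst)) :
    MinRight (l.map Prod.snd) (r.map Prod.snd) := by
  refine ⟨by simpa using hQ.1, ?_⟩
  simp only [List.forall_mem_map]
  intro x hx
  obtain ⟨y, hy, hxy⟩ := hQ.2 _ (List.mem_map_of_mem hx)
  obtain ⟨q, hq, rfl⟩ := List.mem_map.1 hy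
  exact ⟨q.2, List.mem_map_of_mem hq, not_le.1 fun h' => (((h x hx q hq).2 h').trans_lt hxy).false⟩

/-- `MaxRight` lets the dominating letter of r depend on the letter of l; the maximum of r serves
for all of them. -/
theorem isAndreI_iff {w : List ℕ} (hw : w.Nodup) : IsAndreI w ↔ IsNodeWord MaxRight w := by
  constructor
  · intro h
    clear hw
    induction h with
    | nil => exact .nil
    | singleton a => exact .singleton a
    | node l m r _ h2 hl hr h3 ihl ihr =>
      simp only [List.mem_append] at h2 h3
      obtain ⟨M, hM, h3⟩ := h3
      exact .node _ _ _ (fun x hx => h2 x (.inl hx)) (fun x hx => (h2 x (.inr hx)).le) ihl ihr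
        ⟨List.ne_nil_of_mem hM, fun x hx => ⟨M, hM, h3 x (.inl hx)⟩⟩
  · intro h
    induction h with
    | nil => exact .nil
    | singleton a => exact .singleton a
    | node l m r h1 h2 hl hr h3 ihl ihr =>
      have hmr := hw.of_append_right
      rw [List.nodup_cons] at hmr
      refine .node _ _ _ hw ?_ (ihl hw.of_append_left) (ihr hmr.2) ?_
      · simp only [List.mem_append]
        rintro x (hx | hx)
        · exact h1 x hx
        · exact lt_of_le_of_ne (h2 x hx) (by rintro rfl; exact hmr.1 hx)
      · obtain ⟨M, hM⟩ := List.maximum_ne_bot_of_ne_nil h3.1 |> WithBot.ne_bot_iff_exists.1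
        refine ⟨M, List.maximum_mem hM.symm, ?_⟩
        simp only [List.mem_append]
        rintro x (hx | hx)
        · obtain ⟨y, hy, hxy⟩ := h3.2 x hx
          exact hxy.trans (List.le_maximum_of_mem hy hM.symm)
        · exact List.le_maximum_of_mem hx hM.symm

theorem isAndreII_iff {w : List ℕ} (hw : w.Nodup) : IsAndreII w ↔ IsNodeWord MinRight w := by
  constructor
  · intro h
    induction h with
    | nil => exact .nil
    | singleton a => exact .singleton a
    | node l m r _ h2 hl hr h3 ihl ihr =>
      simp only [List.mem_append] at h2 h3
      obtain ⟨M, hM, h3⟩ := h3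
      have hmr := hw.of_append_right
      rw [List.nodup_cons] at hmr
      refine .node _ _ _ (fun x hx => h2 x (.inl hx)) (fun x hx => (h2 x (.inr hx)).le)
        (ihl hw.of_append_left) (ihr hmr.2)
        ⟨List.ne_nil_of_mem hM, fun x hx => ⟨M, hM, lt_of_le_of_ne (h3 x (.inl hx)) ?_⟩⟩
      rintro rfl
      exact (List.nodup_append.1 hw).2.2 M hx M (by simp [hM]) rfl
  · intro h
    induction h with
    | nil => exact .nil
    | singleton a => exact .singleton a
    | node l m r h1 h2 hl hr h3 ihl ihr =>
      have hmr := hw.of_append_right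
      rw [List.nodup_cons] at hmr
      refine .node _ _ _ hw ?_ (ihl hw.of_append_left) (ihr hmr.2) ?_
      · simp only [List.mem_append]
        rintro x (hx | hx)
        · exact h1 x hx
        · exact lt_of_le_of_ne (h2 x hx) (by rintro rfl; exact hmr.1 hx)
      · obtain ⟨M, hM⟩ := List.minimum_ne_top_of_ne_nil h3.1 |> WithTop.ne_top_iff_exists.1
        refine ⟨M, List.minimum_mem hM.symm, ?_⟩
        simp only [List.mem_append]
        rintro x (hx | hx)
        · obtain ⟨y, hy, hxy⟩ := h3.2 x hx
          exact (List.minimum_le_of_mem hy hM.symm).trans hxy.le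
        · exact List.minimum_le_of_mem hx hM.symm

/-! ### Word sums and the decomposition at the leftmost zero -/

/-- The sum of the weights of the words of a language. -/
noncomputable def wordSum {B : Type*} [Ring B] (a b : B) (L : Set (List ℕ)) : B :=
  ∑ᶠ w ∈ L, stepWeight a b 0 w

/-- The words with letters less than `k`. -/
def boundedWords (k : ℕ) : Set (List ℕ) := {w | ∀ x ∈ w, x < k}

section

variable {B : Type*} [Ring B]

theorem wordSum_union (F : NilFiltration B) {a b : B} (ha : a ∈ F.J 1) (hb : b ∈ F.J 1)
    {L M : Set (List ℕ)} {k : ℕ} (hL : L ⊆ boundedWords k) (hM : M ⊆ boundedWords k)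
    (h : Disjoint L M) : wordSum a b (L ∪ M) = wordSum a b L + wordSum a b M :=
  finsum_mem_union' h (F.finite_inter_support (stepWeight_mem F ha hb 0) hL)
    (F.finite_inter_support (stepWeight_mem F ha hb 0) hM)

theorem wordSum_map_succ (a b : B) (L : Set (List ℕ)) :
    wordSum a b (List.map (· + 1) '' L) = wordSum a b L := by
  unfold wordSum
  rw [finsum_mem_image (List.map_injective_iff.2 (add_left_injective 1)).injOn]
  exact finsum_mem_congr rfl fun w _ => stepWeight_zero_map_succ a b w

theorem wordSum_cons_zero (F : NilFiltration B) {a b : B} (ha : a ∈ F.J 1) (hb : b ∈ F.J 1)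
    {L : Set (List ℕ)} {k : ℕ} (hL : L ⊆ boundedWords k) :
    wordSum a b (List.cons 0 '' L) = a * wordSum a b L := by
  unfold wordSum
  rw [finsum_mem_image List.cons_injective.injOn,
    ← mul_finsum_mem_of_finite _ _ (F.finite_inter_support (stepWeight_mem F ha hb 0) hL)]
  exact finsum_mem_congr rfl fun w _ => stepWeight_cons a b (by simp)

theorem map_succ_append_zero_cons_inj {l l' r r' : List ℕ}
    (h : l.map (· + 1) ++ 0 :: r = l'.map (· + 1) ++ 0 :: r') : l = l' ∧ r = r' := by
  obtain ⟨h1, -, h2⟩ := append_cons_inj_of_min h (by simp) (by simp) (by simp) (by simp)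
  exact ⟨List.map_injective_iff.2 (add_left_injective 1) h1, h2⟩

/-- The raised left factor is positive and nonempty, so the zero after it completes a descent and
contributes b; after an empty left factor it would contribute a. -/
theorem wordSum_append_zero_cons (F : NilFiltration B) {a b : B} (ha : a ∈ F.J 1)
    (hb : b ∈ F.J 1) {L M : Set (List ℕ)} {k : ℕ} (hL : L ⊆ boundedWords k)
    (hM : M ⊆ boundedWords k) (h0 : [] ∉ L) :
    wordSum a b ((fun p : List ℕ × List ℕ => p.1.map (· + 1) ++ 0 :: p.2) '' L ×ˢ M) =
      wordSum a b L * b * wordSum a b M := by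
  unfold wordSum
  have hfin := F.finite_inter_support (stepWeight_mem F ha hb 0) hL
  rw [finsum_mem_image, ← finsum_mem_mul_of_finite _ _ hfin, ← finsum_mem_prod_mul _ _
    (hfin.subset ?_) (F.finite_inter_support (stepWeight_mem F ha hb 0) hM)]
  · refine finsum_mem_congr rfl fun p hp => ?_
    rw [stepWeight_append_cons a b _ (by simp) (by simp), stepWeight_zero_map_succ]
    obtain ⟨l, r⟩ := p
    rintro h
    rw [List.map_eq_nil_iff] at h
    exact h0 (h ▸ hp.1)
  · rintro w ⟨h1, h2⟩
    exact ⟨h1, left_ne_zero_of_mul h2⟩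
  · rintro ⟨l, r⟩ _ ⟨l', r'⟩ _ h
    obtain ⟨rfl, rfl⟩ := map_succ_append_zero_cons_inj h
    rfl

/-- The factor a stands for a leading zero, and T b, with T the sum over W, for a nonempty left part
followed by its zero. E collects the words that do not split off a right part in Y. -/
theorem wordSum_rec (F : NilFiltration B) {a b : B} (ha : a ∈ F.J 1) (hb : b ∈ F.J 1)
    {E W Y : Set (List ℕ)} {k : ℕ} (hW : W ⊆ boundedWords k) (hY : Y ⊆ boundedWords (k + 1))
    (h0 : [] ∉ W)
    (hE : ∀ l : List ℕ, ∀ r ∈ Y, l.map (· + 1) ++ 0 :: r ∉ E)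
    (hYE : ∀ w, w ∈ Y ↔ w ∈ E ∨ (∃ r ∈ Y, w = 0 :: r) ∨
      ∃ l ∈ W, ∃ r ∈ Y, w = l.map (· + 1) ++ 0 :: r) :
    wordSum a b Y = wordSum a b E + (a + wordSum a b W * b) * wordSum a b Y := by
  have hcons : List.cons 0 '' Y ⊆ Y := by
    rintro _ ⟨r, hr, rfl⟩
    exact (hYE _).2 (.inr (.inl ⟨r, hr, rfl⟩))
  have hnode : (fun p : List ℕ × List ℕ => p.1.map (· + 1) ++ 0 :: p.2) '' W ×ˢ Y ⊆ Y := by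
    rintro _ ⟨⟨l, r⟩, ⟨hl, hr⟩, rfl⟩
    exact (hYE _).2 (.inr (.inr ⟨l, hl, r, hr, rfl⟩))
  have hset : Y = E ∪ (List.cons 0 '' Y ∪
      (fun p : List ℕ × List ℕ => p.1.map (· + 1) ++ 0 :: p.2) '' W ×ˢ Y) := by
    ext w
    rw [hYE]
    simp only [Set.mem_union, Set.mem_image, Set.mem_prod, Prod.exists]
    refine or_congr_right (or_congr ?_ ?_)
    · exact exists_congr fun r => and_congr_right fun _ => eq_comm
    · constructor
      · rintro ⟨l, hl, r, hr, rfl⟩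
        exact ⟨l, r, ⟨hl, hr⟩, rfl⟩
      · rintro ⟨l, r, ⟨hl, hr⟩, rfl⟩
        exact ⟨l, hl, r, hr, rfl⟩
  conv_lhs => rw [hset]
  have hEY : E ⊆ Y := fun w hw => (hYE w).2 (.inl hw)
  rw [wordSum_union F ha hb (hEY.trans hY)
      (Set.union_subset (hcons.trans hY) (hnode.trans hY)),
    wordSum_union F ha hb (hcons.trans hY) (hnode.trans hY), wordSum_cons_zero F ha hb hY,
    wordSum_append_zero_cons F ha hb (fun w hw x hx => (hW hw x hx).trans (Nat.lt_succ_self k))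
      hY h0, add_mul]
  · rw [Set.disjoint_left]
    rintro _ ⟨r, hr, rfl⟩ ⟨⟨l, r'⟩, ⟨hl, hr'⟩, h⟩
    obtain ⟨rfl, -⟩ := map_succ_append_zero_cons_inj (l' := []) h
    exact h0 hl
  · rw [Set.disjoint_right]
    rintro _ (⟨r, hr, rfl⟩ | ⟨⟨l, r⟩, ⟨hl, hr⟩, rfl⟩)
    exacts [hE [] r hr, hE l r hr]

end

/-! ### Word sums of the two André families -/

theorem IsNodeWord.map_succ_iff {Q : List ℕ → List ℕ → Prop}
    (hQ : ∀ l r : List (ℕ × ℕ), (∀ p ∈ l, ∀ q ∈ r, p.1 ≤ q.1 ↔ p.2 ≤ q.2) →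
      Q (l.map Prod.fst) (r.map Prod.fst) → Q (l.map Prod.snd) (r.map Prod.snd))
    {w : List ℕ} : IsNodeWord Q (w.map (· + 1)) ↔ IsNodeWord Q w := by
  have h1 := IsNodeWord.map_snd hQ (p := w.map fun x => (x, x + 1))
    (by simp [List.pairwise_map, List.pairwise_of_forall])
  have h2 := IsNodeWord.map_snd hQ (p := w.map fun x => (x + 1, x))
    (by simp [List.pairwise_map, List.pairwise_of_forall])
  simp only [List.map_map, Function.comp_def, List.map_id'] at h1 h2
  exact ⟨h2, h1⟩

theorem exists_eq_append_zero_cons {w : List ℕ} (h : 0 ∈ w) :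
    ∃ l r : List ℕ, w = l.map (· + 1) ++ 0 :: r := by
  induction w with
  | nil => simp at h
  | cons x w ih =>
    cases x with
    | zero => exact ⟨[], w, rfl⟩
    | succ x =>
      obtain ⟨l, r, rfl⟩ := ih (by simpa using h)
      exact ⟨x :: l, r, rfl⟩

theorem exists_eq_map_succ {w : List ℕ} (h : 0 ∉ w) : ∃ v : List ℕ, w = v.map (· + 1) := by
  refine ⟨w.map (· - 1), ?_⟩
  rw [List.map_map]
  conv_lhs => rw [← List.map_id w]
  refine List.map_congr_left fun x hx => ?_
  have : x ≠ 0 := by rintro rfl; exact h hx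
  simp only [id, Function.comp_apply]
  omega

/-- The nonempty node words with letters less than `k`. -/
def nodeWords (Q : List ℕ → List ℕ → Prop) (k : ℕ) : Set (List ℕ) :=
  {w | w ≠ [] ∧ IsNodeWord Q w ∧ ∀ x ∈ w, x < k}

theorem nodeWords_zero (Q : List ℕ → List ℕ → Prop) : nodeWords Q 0 = ∅ := by
  ext w
  simp only [nodeWords, Set.mem_ofPred_eq, Set.mem_empty_iff_false, iff_false]
  rintro ⟨h, -, h'⟩
  obtain ⟨x, hx⟩ := List.exists_mem_of_ne_nil w h
  exact Nat.not_lt_zero _ (h' x hx)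

section

variable {B : Type*} [Ring B]

/-- X_k sums the words that attain the bound k - 1. When such a word is cut at its leftmost zero,
`MaxRight` forces the right part to attain the bound too and leaves the left part free; the words
without zero are shifts of those counted by X_{k-1}. -/
theorem wordSum_maxRight (F : NilFiltration B) {a b : B} (ha : a ∈ F.J 1) (hb : b ∈ F.J 1)
    (k : ℕ) : wordSum a b (nodeWords MaxRight k) =
      (∑ i ∈ Finset.range k, insertionSeries (i + 1) a (a * b)) * a := by
  let Y : ℕ → Set (List ℕ) := fun k => {w | w ∈ nodeWords MaxRight k ∧ ∃ x ∈ w, x + 1 = k}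
  have hYb : ∀ k, Y k ⊆ boundedWords k := fun k w hw => hw.1.2.2
  have hY0 : ∀ k w, w ∈ Y k → w ≠ [] := fun k w hw => hw.1.1
  have hnode : ∀ k l r, l.map (· + 1) ++ 0 :: r ∈ Y (k + 1) ↔
      (k = 0 ∧ l = [] ∧ r = []) ∨
      ((l = [] ∨ l ∈ nodeWords MaxRight k) ∧ r ∈ Y (k + 1)) := by
    intro k l r
    simp only [Y, nodeWords, Set.mem_ofPred_eq]
    rw [isNodeWord_append_cons_iff (by simp) (by simp),
      IsNodeWord.map_succ_iff maxRight_map]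
    constructor
    · rintro ⟨⟨-, h | ⟨hl, hr, h1, h2⟩, hb⟩, x, hx, hxk⟩
      · obtain ⟨h, rfl⟩ := h
        rw [List.map_eq_nil_iff] at h
        subst h
        simp only [List.map_nil, List.nil_append, List.mem_singleton] at hx
        left
        exact ⟨by omega, rfl, rfl⟩
      · right
        refine ⟨?_, ⟨h1, hr, fun x hx => hb x (by simp [hx])⟩, ?_⟩
        · refine or_iff_not_imp_left.2 fun h => ⟨h, hl, fun x hx => ?_⟩
          have := hb (x + 1) (by simp [hx])
          omega
        · obtain ⟨y, hy, hxy⟩ : ∃ y ∈ r, x ≤ y := by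
            simp only [List.mem_append, List.mem_cons] at hx
            rcases hx with hx | rfl | hx
            · exact h2 x hx
            · obtain ⟨y, hy⟩ := List.exists_mem_of_ne_nil r h1
              exact ⟨y, hy, y.zero_le⟩
            · exact ⟨x, hx, le_rfl⟩
          have := hb y (by simp [hy])
          exact ⟨y, hy, by omega⟩
    · rintro (⟨rfl, rfl, rfl⟩ | ⟨hl, ⟨h1, hr, hb⟩, x, hx, hxk⟩)
      · simp
      · have hl1 : IsNodeWord MaxRight l := by
          rcases hl with rfl | hl
          exacts [.nil, hl.2.1]
        have hl2 : ∀ y ∈ l, y < k := by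
          rcases hl with rfl | hl
          exacts [by simp, hl.2.2]
        refine ⟨⟨by simp, .inr ⟨hl1, hr, h1, ?_⟩, ?_⟩, x, by simp [hx], hxk⟩
        · simp only [List.forall_mem_map]
          intro y hy
          exact ⟨x, hx, by have := hl2 y hy; omega⟩
        · simp only [List.mem_append, List.mem_cons, List.mem_map]
          rintro y (⟨y, hy, rfl⟩ | rfl | hy)
          exacts [by simpa using hl2 y hy, by simp, hb y hy]
  have hnode' : ∀ k r, 0 :: r ∈ Y (k + 1) ↔ (k = 0 ∧ r = []) ∨ r ∈ Y (k + 1) := by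
    intro k r
    simpa using hnode k [] r
  have hsucc : ∀ k w, List.map (· + 1) w ∈ Y (k + 1) ↔ w ∈ Y k := by
    intro k w
    simp [Y, nodeWords, IsNodeWord.map_succ_iff maxRight_map]
  refine eq_insertionSeries_of_rec F a b ha hb (fun k => wordSum a b (Y k))
    (fun k => wordSum a b (nodeWords MaxRight k)) ?_ ?_ ?_ ?_ k
  · simp [nodeWords_zero, wordSum]
  · intro k
    rw [← wordSum_union F ha hb (k := k + 1) (fun w hw x hx => (hw.2.2 x hx).trans k.lt_succ_self)
      (hYb _)]
    · congr 1
      ext w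
      simp only [Y, nodeWords, Set.mem_union, Set.mem_ofPred_eq]
      constructor
      · rintro ⟨h1, h2, h3⟩
        by_cases h : ∃ x ∈ w, x + 1 = k + 1
        · exact .inr ⟨⟨h1, h2, h3⟩, h⟩
        · push Not at h
          exact .inl ⟨h1, h2, fun x hx => by have := h x hx; have := h3 x hx; omega⟩
      · rintro (⟨h1, h2, h3⟩ | h)
        exacts [⟨h1, h2, fun x hx => (h3 x hx).trans k.lt_succ_self⟩, h.1]
    · rw [Set.disjoint_left]
      rintro w hw ⟨-, x, hx, hk⟩
      have := hw.2.2 x hx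
      omega
  -- Over the alphabet {0} the only word that does not split is the single letter, of weight a.
  · have := wordSum_rec F ha hb (E := {[0]}) (W := nodeWords MaxRight 0) (Y := Y 1) (k := 0)
      (fun w hw => hw.2.2) (hYb _) (fun h => h.1 rfl) ?_ ?_
    · have h0 : wordSum a b {[0]} = a := by simp [wordSum, stepWeight]
      rwa [h0] at this
    · rintro l r hr h
      obtain ⟨-, rfl⟩ := map_succ_append_zero_cons_inj (l' := []) (r' := []) h
      exact hY0 _ _ hr rfl
    · intro w
      have hall : w ∈ Y 1 → 0 ∈ w := by
        rintro ⟨-, x, hx, hx1⟩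
        rwa [show x = 0 by omega] at hx
      constructor
      · intro h
        obtain ⟨l, r, rfl⟩ := exists_eq_append_zero_cons (hall h)
        rcases (hnode 0 l r).1 h with ⟨-, rfl, rfl⟩ | ⟨rfl | hl, hr⟩
        exacts [.inl rfl, .inr (.inl ⟨r, hr, rfl⟩), .inr (.inr ⟨l, hl, r, hr, rfl⟩)]
      · rintro (rfl | ⟨r, hr, rfl⟩ | ⟨l, hl, r, hr, rfl⟩)
        · exact (hnode' 0 []).2 (.inl ⟨rfl, rfl⟩)
        · exact (hnode' 0 r).2 (.inr hr)
        · exact (hnode 0 l r).2 (.inr ⟨.inr hl, hr⟩)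
  · intro k
    have := wordSum_rec F ha hb (E := List.map (· + 1) '' Y (k + 1))
      (W := nodeWords MaxRight (k + 1)) (Y := Y (k + 2)) (k := k + 1)
      (fun w hw => hw.2.2) (hYb _) (fun h => h.1 rfl) ?_ ?_
    · simpa only [wordSum_map_succ] using this
    · rintro l r hr ⟨w, -, hw⟩
      have : 0 ∈ List.map (· + 1) w := by simp [hw]
      simp at this
    · intro w
      constructor
      · intro h
        by_cases h0 : 0 ∈ w
        · obtain ⟨l, r, rfl⟩ := exists_eq_append_zero_cons h0
          rcases (hnode (k + 1) l r).1 h with ⟨h, -⟩ | ⟨rfl | hl, hr⟩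
          exacts [absurd h k.succ_ne_zero, .inr (.inl ⟨r, hr, rfl⟩),
            .inr (.inr ⟨l, hl, r, hr, rfl⟩)]
        · obtain ⟨v, rfl⟩ := exists_eq_map_succ h0
          exact .inl ⟨v, (hsucc _ v).1 h, rfl⟩
      · rintro (⟨v, hv, rfl⟩ | ⟨r, hr, rfl⟩ | ⟨l, hl, r, hr, rfl⟩)
        · exact (hsucc _ v).2 hv
        · exact (hnode' (k + 1) r).2 (.inr hr)
        · exact (hnode (k + 1) l r).2 (.inr ⟨.inr hl, hr⟩)

/-- Raising all letters except the cutting zero changes no comparison inside either part, and the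
zero still completes a descent exactly when the left part is nonempty. -/
theorem wordSum_map_succ_right (a b : B) (D : Set (List ℕ × List ℕ)) :
    wordSum a b ((fun p : List ℕ × List ℕ =>
        (p.1.map (· + 1)).map (· + 1) ++ 0 :: p.2.map (· + 1)) '' D) =
      wordSum a b ((fun p : List ℕ × List ℕ => p.1.map (· + 1) ++ 0 :: p.2) '' D) := by
  unfold wordSum
  rw [finsum_mem_image, finsum_mem_image]
  · refine finsum_mem_congr rfl ?_
    rintro ⟨l, r⟩ -
    rcases eq_or_ne l [] with rfl | hl
    · simp [stepWeight_cons, stepWeight_zero_map_succ]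
    · rw [stepWeight_append_cons a b (by simpa using hl) (by simp) (by simp),
        stepWeight_append_cons a b (by simpa using hl) (by simp) (by simp),
        stepWeight_zero_map_succ]
      exact congrArg _ (stepWeight_zero_map_succ a b r)
  · rintro ⟨l, r⟩ _ ⟨l', r'⟩ _ h
    obtain ⟨rfl, rfl⟩ := map_succ_append_zero_cons_inj h
    rfl
  · rintro ⟨l, r⟩ _ ⟨l', r'⟩ _ h
    have hinj : Function.Injective (List.map (· + 1)) :=
      List.map_injective_iff.2 (add_left_injective 1)
    obtain ⟨h1, h2⟩ := map_succ_append_zero_cons_inj h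
    exact Prod.ext (hinj h1) (hinj h2)

/-- X_k sums the words that contain 0; the others are shifts of words over a smaller alphabet. If a
second zero follows the leftmost one, `MinRight` is automatic and the word factors. If not, all
letters but that zero can be lowered by one, which gives the words counted by X_{k-1}. -/
theorem wordSum_minRight (F : NilFiltration B) {a b : B} (ha : a ∈ F.J 1) (hb : b ∈ F.J 1)
    (k : ℕ) : wordSum a b (nodeWords MinRight k) =
      (∑ i ∈ Finset.range k, insertionSeries (i + 1) a (a * b)) * a := by
  let Y : ℕ → Set (List ℕ) := fun k => {w | w ∈ nodeWords MinRight k ∧ 0 ∈ w}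
  have hYb : ∀ k, Y k ⊆ boundedWords k := fun k w hw => hw.1.2.2
  have hnode : ∀ k l r, l.map (· + 1) ++ 0 :: r ∈ Y (k + 1) ↔
      (l = [] ∧ r = []) ∨
      (IsNodeWord MinRight l ∧ IsNodeWord MinRight r ∧ MinRight (l.map (· + 1)) r ∧
        (∀ x ∈ l, x < k) ∧ (∀ x ∈ r, x < k + 1)) := by
    intro k l r
    simp only [Y, nodeWords, Set.mem_ofPred_eq]
    rw [isNodeWord_append_cons_iff (by simp) (by simp),
      IsNodeWord.map_succ_iff minRight_map, List.map_eq_nil_iff]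
    have hb : (∀ x ∈ l.map (· + 1) ++ 0 :: r, x < k + 1) ↔
        (∀ x ∈ l, x < k) ∧ (∀ x ∈ r, x < k + 1) := by
      rw [List.forall_mem_append, List.forall_mem_cons, List.forall_mem_map]
      simp
    rw [hb]
    constructor
    · rintro ⟨⟨-, h1 | h1, h2⟩, -⟩
      exacts [.inl h1, .inr ⟨h1.1, h1.2.1, h1.2.2, h2⟩]
    · rintro (⟨rfl, rfl⟩ | ⟨h1, h2, h3, h4⟩)
      · simp
      · exact ⟨⟨by simp, .inr ⟨h1, h2, h3⟩, h4⟩, by simp⟩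
  have hzero : ∀ k l r, 0 ∈ r → (l.map (· + 1) ++ 0 :: r ∈ Y (k + 1) ↔
      (l = [] ∨ l ∈ nodeWords MinRight k) ∧ r ∈ Y (k + 1)) := by
    intro k l r h0
    have hr : r ≠ [] := List.ne_nil_of_mem h0
    have hQ : MinRight (l.map (· + 1)) r := by
      refine ⟨hr, ?_⟩
      simp only [List.forall_mem_map]
      exact fun x _ => ⟨0, h0, x.succ_pos⟩
    rw [hnode]
    simp only [Y, nodeWords, Set.mem_ofPred_eq]
    constructor
    · rintro (⟨-, h⟩ | ⟨h1, h2, -, h3, h4⟩)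
      · exact absurd h hr
      · exact ⟨or_iff_not_imp_left.2 fun h => ⟨h, h1, h3⟩, ⟨hr, h2, h4⟩, h0⟩
    · rintro ⟨rfl | hl, ⟨-, h2, h4⟩, -⟩
      · exact .inr ⟨.nil, h2, hQ, by simp, h4⟩
      · exact .inr ⟨hl.2.1, h2, hQ, hl.2.2, h4⟩
  refine eq_insertionSeries_of_rec F a b ha hb (fun k => wordSum a b (Y k))
    (fun k => wordSum a b (nodeWords MinRight k)) ?_ ?_ ?_ ?_ k
  · simp [nodeWords_zero, wordSum]
  · intro k
    rw [← wordSum_map_succ a b (nodeWords MinRight k),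
      ← wordSum_union F ha hb (k := k + 1) ?_ (hYb _)]
    · congr 1
      ext w
      constructor
      · intro h
        by_cases h0 : 0 ∈ w
        · exact .inr ⟨h, h0⟩
        · obtain ⟨v, rfl⟩ := exists_eq_map_succ h0
          refine .inl ⟨v, ?_, rfl⟩
          simpa [nodeWords, IsNodeWord.map_succ_iff minRight_map] using h
      · rintro (⟨v, hv, rfl⟩ | h)
        · simpa [nodeWords, IsNodeWord.map_succ_iff minRight_map] using hv
        · exact h.1
    · rw [Set.disjoint_left]
      rintro _ ⟨v, -, rfl⟩ ⟨-, h⟩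
      simp at h
    · rintro _ ⟨v, hv, rfl⟩
      simpa [boundedWords] using hv.2.2
  · have := wordSum_rec F ha hb (E := {[0]}) (W := nodeWords MinRight 0) (Y := Y 1) (k := 0)
      (fun w hw => hw.2.2) (hYb _) (fun h => h.1 rfl) ?_ ?_
    · have h0 : wordSum a b {[0]} = a := by simp [wordSum, stepWeight]
      rwa [h0] at this
    · rintro l r hr h
      obtain ⟨-, rfl⟩ := map_succ_append_zero_cons_inj (l' := []) (r' := []) h
      exact hr.1.1 rfl
    · intro w
      constructor
      · intro h
        obtain ⟨l, r, rfl⟩ := exists_eq_append_zero_cons h.2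
        by_cases h0 : 0 ∈ r
        · obtain ⟨rfl | hl, hr⟩ := (hzero 0 l r h0).1 h
          exacts [.inr (.inl ⟨r, hr, rfl⟩), .inr (.inr ⟨l, hl, r, hr, rfl⟩)]
        · rcases (hnode 0 l r).1 h with ⟨rfl, rfl⟩ | ⟨-, -, hQ, -, hr⟩
          · exact .inl rfl
          · obtain ⟨x, hx⟩ := List.exists_mem_of_ne_nil r hQ.1
            have := hr x hx
            rw [show x = 0 by omega] at hx
            exact absurd hx h0
      · rintro (rfl | ⟨r, hr, rfl⟩ | ⟨l, hl, r, hr, rfl⟩)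
        · exact (hnode 0 [] []).2 (.inl ⟨rfl, rfl⟩)
        · exact (hzero 0 [] r hr.2).2 ⟨.inl rfl, hr⟩
        · exact (hzero 0 l r hr.2).2 ⟨.inr hl, hr⟩
  · intro k
    let D : Set (List ℕ × List ℕ) := {p | p.1.map (· + 1) ++ 0 :: p.2 ∈ Y (k + 1)}
    have hD : Y (k + 1) = (fun p : List ℕ × List ℕ => p.1.map (· + 1) ++ 0 :: p.2) '' D := by
      ext w
      constructor
      · intro h
        obtain ⟨l, r, rfl⟩ := exists_eq_append_zero_cons h.2
        exact ⟨(l, r), h, rfl⟩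
      · rintro ⟨p, hp, rfl⟩
        exact hp
    have hshift : ∀ l r : List ℕ, (l.map (· + 1)) ++ 0 :: r.map (· + 1) ∈ Y (k + 2) ↔
        ∃ l', l = l'.map (· + 1) ∧ (l', r) ∈ D := by
      intro l r
      simp only [D, Set.mem_ofPred_eq, hnode]
      constructor
      · rintro (⟨rfl, h⟩ | ⟨hl, hr, hQ, hlk, hrk⟩)
        · exact ⟨[], rfl, .inl ⟨rfl, by simpa using h⟩⟩
        · rw [IsNodeWord.map_succ_iff minRight_map] at hr
          have hQ' : MinRight l r := by
            refine ⟨by simpa using hQ.1, fun x hx => ?_⟩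
            obtain ⟨y, hy, hxy⟩ := hQ.2 (x + 1) (by simpa using hx)
            obtain ⟨z, hz, rfl⟩ := List.mem_map.1 hy
            exact ⟨z, hz, by simpa using hxy⟩
          -- In the original word the left letters exceed some positive letter of the right part, so
          -- they are at least 2 and lowering them keeps them above the cutting zero.
          obtain ⟨l, rfl⟩ := exists_eq_map_succ (w := l) fun h0 => by
            obtain ⟨y, -, hy⟩ := hQ'.2 0 h0
            exact y.not_lt_zero hy
          rw [IsNodeWord.map_succ_iff minRight_map] at hl
          exact ⟨l, rfl, .inr ⟨hl, hr, hQ', by simpa using hlk, by simpa using hrk⟩⟩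
      · rintro ⟨l, rfl, ⟨rfl, rfl⟩ | ⟨hl, hr, hQ, hlk, hrk⟩⟩
        · exact .inl ⟨rfl, rfl⟩
        · refine .inr ⟨(IsNodeWord.map_succ_iff minRight_map).2 hl,
            (IsNodeWord.map_succ_iff minRight_map).2 hr, ⟨by simpa using hQ.1, ?_⟩,
            by simpa using hlk, by simpa using hrk⟩
          simp only [List.forall_mem_map]
          intro x hx
          obtain ⟨y, hy, hxy⟩ := hQ.2 (x + 1) (List.mem_map_of_mem hx)
          exact ⟨y + 1, List.mem_map_of_mem hy, by omega⟩
    have := wordSum_rec F ha hb (E := (fun p : List ℕ × List ℕ =>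
        (p.1.map (· + 1)).map (· + 1) ++ 0 :: p.2.map (· + 1)) '' D)
      (W := nodeWords MinRight (k + 1)) (Y := Y (k + 2)) (k := k + 1)
      (fun w hw => hw.2.2) (hYb _) (fun h => h.1 rfl) ?_ ?_
    · rwa [wordSum_map_succ_right, ← hD] at this
    · rintro l r hr ⟨p, -, hp⟩
      obtain ⟨-, rfl⟩ := map_succ_append_zero_cons_inj hp
      simpa using hr.2
    · intro w
      constructor
      · intro h
        obtain ⟨l, r, rfl⟩ := exists_eq_append_zero_cons h.2
        by_cases h0 : 0 ∈ r
        · obtain ⟨rfl | hl, hr⟩ := (hzero (k + 1) l r h0).1 h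
          exacts [.inr (.inl ⟨r, hr, rfl⟩), .inr (.inr ⟨l, hl, r, hr, rfl⟩)]
        · obtain ⟨r, rfl⟩ := exists_eq_map_succ h0
          obtain ⟨l, rfl, hl⟩ := (hshift l r).1 h
          exact .inl ⟨(l, r), hl, rfl⟩
      · rintro (⟨p, hp, rfl⟩ | ⟨r, hr, rfl⟩ | ⟨l, hl, r, hr, rfl⟩)
        · exact (hshift _ _).2 ⟨p.1, rfl, hp⟩
        · exact (hzero (k + 1) [] r hr.2).2 ⟨.inl rfl, hr⟩
        · exact (hzero (k + 1) l r hr.2).2 ⟨.inr hl, hr⟩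

end

/-! ### Simsun words and weights by descent pairs -/

/-- The first two letters of the word form a descent. -/
def StartsDescent : List ℕ → Prop
  | x :: y :: _ => y < x
  | _ => False

/-- For no letter `x` of the word, the subword of the letters which are to the right of `x` and
smaller than `x` starts with a descent. -/
def IsSimsunWord : List ℕ → Prop
  | [] => True
  | x :: v => IsSimsunWord v ∧ ¬ StartsDescent (v.filter (· < x))

theorem IsSimsunWord.not_startsDescent {x y : ℕ} {v : List ℕ} (h : IsSimsunWord (x :: y :: v))
    (hxy : y < x) : ¬ StartsDescent (y :: v) := by
  have h2 := h.2
  cases v with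
  | nil => simp [StartsDescent]
  | cons z v =>
    intro h'
    have hz : z < y := h'
    apply h2
    rw [List.filter_cons_of_pos (by simpa using hxy),
      List.filter_cons_of_pos (by simpa using hz.trans hxy)]
    exact hz

/-- The weight of a word without double descents: a factor `d` for every descent and a factor `c`
for every other letter. -/
def pairWeight {B : Type*} [Ring B] (c d : B) : List ℕ → B
  | [] => 1
  | [_] => c
  | x :: y :: v => if y < x then d * pairWeight c d v else c * pairWeight c d (y :: v)

section

variable {B : Type*} [Ring B]

theorem pairWeight_cons (c d : B) {x : ℕ} {v : List ℕ} (h : ¬ StartsDescent (x :: v)) :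
    pairWeight c d (x :: v) = c * pairWeight c d v := by
  cases v with
  | nil => simp [pairWeight]
  | cons y v => rw [pairWeight, if_neg (show ¬ y < x from h)]

theorem pairWeight_mem (F : NilFiltration B) {c d : B} (hc : c ∈ F.J 1) (hd : d ∈ F.J 2) :
    ∀ w : List ℕ, pairWeight c d w ∈ F.J w.length
  | [] => F.mem_zero _
  | [_] => hc
  | x :: y :: v => by
    rw [pairWeight]
    split_ifs
    · have := F.mul_mem hd (pairWeight_mem F hc hd v)
      rwa [add_comm] at this
    · have := F.mul_mem hc (pairWeight_mem F hc hd (y :: v))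
      rwa [add_comm] at this

/-- The letter after a descent x > y is not below y, so the rest of the word is weighed as if it
were read from the start. Each descent thus contributes a b as one block, and each other letter
contributes a. -/
theorem stepWeight_eq_pairWeight (a b : B) : ∀ w : List ℕ, IsSimsunWord w →
    stepWeight a b 0 w = pairWeight a (a * b) w
  | [], _ => rfl
  | [x], _ => by simp [stepWeight, pairWeight]
  | x :: y :: v, h => by
    rw [pairWeight]
    split_ifs with hxy
    · rw [← stepWeight_eq_pairWeight a b v h.1.1, stepWeight, stepWeight,
        if_neg (Nat.not_lt_zero _), if_pos hxy, mul_assoc]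
      congr 2
      have := h.not_startsDescent hxy
      cases v with
      | nil => rfl
      | cons z v => 
        rw [stepWeight, stepWeight, if_neg (show ¬ z < y from this), if_neg (Nat.not_lt_zero _)]
    · rw [← stepWeight_eq_pairWeight a b (y :: v) h.1, stepWeight, stepWeight, stepWeight,
        if_neg (Nat.not_lt_zero _), if_neg hxy, if_neg (Nat.not_lt_zero _)]

end

/-! ### Insertion of a greatest letter -/

/-- No letter `k` of the word is followed, up to further letters that are not less than `k`, by a
descent. -/
def IsLegal (k : ℕ) : List ℕ → Prop
  | [] => True
  | x :: v => IsLegal k v ∧ (x = k → ¬ StartsDescent (v.filter (· < k)))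

/-- The condition at a letter below k does not see the letters k, and the conditions at the letters
k are legality. -/
theorem isSimsunWord_iff_filter {k : ℕ} {w : List ℕ} (hw : ∀ x ∈ w, x ≤ k) :
    IsSimsunWord w ↔ IsSimsunWord (w.filter (· < k)) ∧ IsLegal k w := by
  induction w with
  | nil => simp [IsSimsunWord, IsLegal]
  | cons x v ih =>
    have ih := ih fun y hy => hw y (by simp [hy])
    rcases (hw x (by simp)).eq_or_lt with rfl | hx
    · rw [List.filter_cons_of_neg (by simp), IsSimsunWord, IsLegal, ih]
      simp [and_assoc]
    · rw [List.filter_cons_of_pos (by simpa using hx), IsSimsunWord, IsLegal, IsSimsunWord, ih,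
        List.filter_filter]
      have : v.filter (fun y => decide (y < x) && decide (y < k)) = v.filter (· < x) :=
        List.filter_congr fun y _ => by
          by_cases hy : y < x
          · simp [hy, hy.trans hx]
          · simp [hy]
      rw [this]
      have hne : x ≠ k := hx.ne
      tauto

/-- The words which are obtained from `v` by legal insertions of letters `k`. -/
def insertions (k : ℕ) (v : List ℕ) : Set (List ℕ) :=
  {w | (∀ x ∈ w, x ≤ k) ∧ w.filter (· < k) = v ∧ IsLegal k w}

theorem nil_mem_insertions (k : ℕ) (v : List ℕ) : [] ∈ insertions k v ↔ v = [] := by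
  simp [insertions, IsLegal, eq_comm]

theorem self_cons_mem_insertions {k : ℕ} {v w : List ℕ} :
    k :: w ∈ insertions k v ↔ w ∈ insertions k v ∧ ¬ StartsDescent v := by
  simp only [insertions, Set.mem_ofPred_eq, List.forall_mem_cons, IsLegal, true_imp_iff]
  rw [List.filter_cons_of_neg (by simp)]
  constructor
  · rintro ⟨h1, rfl, h2⟩
    exact ⟨⟨h1.2, rfl, h2.1⟩, h2.2⟩
  · rintro ⟨⟨h1, rfl, h2⟩, h3⟩
    exact ⟨⟨le_rfl, h1⟩, rfl, h2, h3⟩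

theorem cons_mem_insertions {k y : ℕ} {v w : List ℕ} (hy : y < k) :
    y :: w ∈ insertions k v ↔ ∃ v', v = y :: v' ∧ w ∈ insertions k v' := by
  simp only [insertions, Set.mem_ofPred_eq, List.forall_mem_cons, IsLegal]
  rw [List.filter_cons_of_pos (by simpa using hy)]
  constructor
  · rintro ⟨h1, rfl, h2⟩
    exact ⟨_, rfl, h1.2, rfl, h2.1⟩
  · rintro ⟨v', rfl, h1, rfl, h2⟩
    exact ⟨⟨hy.le, h1⟩, rfl, h2, fun h => absurd h hy.ne⟩

theorem insertions_nil (k : ℕ) :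
    insertions k [] = {[]} ∪ List.cons k '' insertions k [] := by
  ext w
  cases w with
  | nil => simp [nil_mem_insertions]
  | cons y w =>
    rcases lt_trichotomy y k with h | rfl | h
    · simp [cons_mem_insertions h, h.ne']
    · simp [self_cons_mem_insertions, StartsDescent]
    · simp only [Set.mem_union, Set.mem_singleton_iff, reduceCtorEq, false_or, Set.mem_image,
        List.cons.injEq, h.ne, false_and, and_false, exists_false, iff_false]
      exact fun hw => (hw.1 y (by simp)).not_gt h

theorem insertions_cons {k x : ℕ} (hx : x < k) (v : List ℕ) : insertions k (x :: v) =
    List.cons x '' insertions k v ∪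
      List.cons k '' {w | w ∈ insertions k (x :: v) ∧ ¬ StartsDescent (x :: v)} := by
  ext w
  cases w with
  | nil => simp [nil_mem_insertions]
  | cons y w =>
    rcases lt_trichotomy y k with h | rfl | h
    · simp [cons_mem_insertions h, h.ne']
      tauto
    · simp [self_cons_mem_insertions, hx.ne]
    · simp only [Set.mem_union, Set.mem_image, List.cons.injEq, h.ne, (hx.trans h).ne,
        false_and, and_false, exists_false, iff_false, or_false]
      exact fun hw => (hw.1 y (by simp)).not_gt h

theorem insertions_subset (k : ℕ) (v : List ℕ) : insertions k v ⊆ boundedWords (k + 1) :=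
  fun _ hw x hx => Nat.lt_succ_of_le (hw.1 x hx)

theorem not_startsDescent_cons_of_mem_insertions {k x : ℕ} {u v : List ℕ} (hx : x < k)
    (h : ¬ StartsDescent (x :: v)) (hu : u ∈ insertions k v) : ¬ StartsDescent (x :: u) := by
  cases u with
  | nil => simp [StartsDescent]
  | cons y u =>
    rcases (hu.1 y (by simp)).eq_or_lt with rfl | hy
    · exact hx.le.not_gt
    · obtain ⟨v', rfl, -⟩ := (cons_mem_insertions hy).1 hu
      exact h

section

variable {B : Type*} [Ring B]

theorem finsum_insertions_cons (F : NilFiltration B) {f : List ℕ → B}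
    (hf : ∀ w, f w ∈ F.J w.length) {k x : ℕ} (hx : x < k) (v : List ℕ) :
    ∑ᶠ w ∈ insertions k (x :: v), f w = ∑ᶠ w ∈ insertions k v, f (x :: w) +
      ∑ᶠ w ∈ {w | w ∈ insertions k (x :: v) ∧ ¬ StartsDescent (x :: v)}, f (k :: w) := by
  have hsub := insertions_subset k (x :: v)
  rw [insertions_cons hx, Set.union_subset_iff] at hsub
  rw [insertions_cons hx, finsum_mem_union' _ (F.finite_inter_support hf hsub.1)
    (F.finite_inter_support hf hsub.2), finsum_mem_image List.cons_injective.injOn,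
    finsum_mem_image List.cons_injective.injOn, ← insertions_cons hx]
  rw [Set.disjoint_left]
  rintro _ ⟨u, -, rfl⟩ ⟨w, -, h⟩
  simp only [List.cons.injEq] at h
  exact hx.ne h.1.symm

theorem finsum_insertions_nil (F : NilFiltration B) {c d : B} (hc : c ∈ F.J 1) (hd : d ∈ F.J 2)
    (k : ℕ) : ∑ᶠ w ∈ insertions k [], pairWeight c d w = geomInv c := by
  have hf := pairWeight_mem F hc hd
  have hsub := insertions_subset k []
  rw [insertions_nil, Set.union_subset_iff] at hsub
  apply (F.isUnit_one_sub hc).mul_left_cancel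
  rw [mul_geomInv F hc, sub_mul, one_mul, sub_eq_iff_eq_add]
  conv_lhs => rw [insertions_nil]
  rw [finsum_mem_union' _ (F.finite_inter_support hf hsub.1) (F.finite_inter_support hf hsub.2),
    finsum_mem_image List.cons_injective.injOn, finsum_mem_singleton,
    ← mul_finsum_mem_of_finite _ _ (F.finite_inter_support hf (insertions_subset k []))]
  · congr 1
    refine finsum_mem_congr rfl fun w hw => pairWeight_cons c d ?_
    cases w with
    | nil => simp [StartsDescent]
    | cons y w =>
      rcases (hw.1 y (by simp)).eq_or_lt with rfl | hy
      · exact lt_irrefl y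
      · simp [cons_mem_insertions hy] at hw
  · simp

/-- A positive number of copies of k before x gives c^j d: the last copy forms a descent with x and
the others are single. The series is summed through its fixed-point equation. -/
theorem finsum_insertions_self_cons (F : NilFiltration B) {c d : B} (hc : c ∈ F.J 1)
    (hd : d ∈ F.J 2) {k x : ℕ} (hx : x < k) {v : List ℕ} (h : ¬ StartsDescent (x :: v)) :
    ∑ᶠ w ∈ insertions k (x :: v), pairWeight c d (k :: w) =
      geomInv c * d * ∑ᶠ w ∈ insertions k v, pairWeight c d w := by
  have hf := pairWeight_mem F hc hd
  have hf' : ∀ w, pairWeight c d (k :: w) ∈ F.J w.length := fun w =>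
    F.anti (Nat.le_succ _) (hf (k :: w))
  apply (F.isUnit_one_sub hc).mul_left_cancel
  rw [mul_assoc, ← mul_assoc (1 - c), mul_geomInv F hc, one_mul, sub_mul, one_mul,
    sub_eq_iff_eq_add]
  conv_lhs => rw [finsum_insertions_cons F hf' hx]
  simp only [h, not_false_iff, and_true, Set.ofPred_mem_eq]
  rw [← mul_finsum_mem_of_finite _ _ (F.finite_inter_support hf (insertions_subset k v)),
    ← mul_finsum_mem_of_finite _ _ (F.finite_inter_support hf' (insertions_subset k (x :: v)))]
  congr 1
  · exact finsum_mem_congr rfl fun w _ => by rw [pairWeight, if_pos hx]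
  · exact finsum_mem_congr rfl fun w _ => by rw [pairWeight, if_neg (lt_irrefl k)]

/-- Put g = `geomInv c`. A letter outside descents may be preceded by copies of k, which turns c
into c + g d. A descent admits copies only between its two letters, which turns d into g d. Copies
at the end give the final g. -/
theorem finsum_insertions (F : NilFiltration B) {c d : B} (hc : c ∈ F.J 1) (hd : d ∈ F.J 2)
    (k : ℕ) : ∀ v : List ℕ, (∀ x ∈ v, x < k) → IsSimsunWord v →
    ∑ᶠ w ∈ insertions k v, pairWeight c d w =
      pairWeight (c + geomInv c * d) (geomInv c * d) v * geomInv c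
  | [], _, _ => by rw [finsum_insertions_nil F hc hd, pairWeight, one_mul]
  | x :: v, hv, hs => by
    have hf := pairWeight_mem F hc hd
    have hf' : ∀ y w, pairWeight c d (y :: w) ∈ F.J w.length := fun y w =>
      F.anti (Nat.le_succ _) (hf (y :: w))
    have hx := hv x (by simp)
    -- For a descent x > y, no copy may precede x. Placing none or some between x and y gives d + c
    -- g d, which equals g d because c g = g - 1.
    by_cases h : StartsDescent (x :: v)
    · rcases v with - | ⟨y, v⟩
      · simp [StartsDescent] at h
      · have hxy : y < x := h
        have hy := hs.not_startsDescent hxy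
        have ih := finsum_insertions F hc hd k v (fun z hz => hv z (by simp [hz])) hs.1.1
        rw [finsum_insertions_cons F hf hx]
        simp only [h, not_true, and_false, Set.ofPred_false, finsum_mem_empty, add_zero]
        rw [finsum_insertions_cons F (hf' x) (hxy.trans hx)]
        simp only [hy, not_false_iff, and_true, Set.ofPred_mem_eq]
        have e1 : ∑ᶠ w ∈ insertions k v, pairWeight c d (x :: y :: w) =
            d * ∑ᶠ w ∈ insertions k v, pairWeight c d w := by
          rw [← mul_finsum_mem_of_finite _ _ (F.finite_inter_support hf (insertions_subset k v))]
          exact finsum_mem_congr rfl fun w _ => by rw [pairWeight, if_pos hxy]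
        have e2 : ∑ᶠ w ∈ insertions k (y :: v), pairWeight c d (x :: k :: w) =
            c * ∑ᶠ w ∈ insertions k (y :: v), pairWeight c d (k :: w) := by
          rw [← mul_finsum_mem_of_finite _ _
            (F.finite_inter_support (hf' k) (insertions_subset k (y :: v)))]
          exact finsum_mem_congr rfl fun w _ => by rw [pairWeight, if_neg hx.not_gt]
        have e3 : c * geomInv c = geomInv c - 1 := by
          rw [eq_sub_iff_add_eq', ← mul_geomInv F hc, sub_mul, one_mul, sub_add_cancel]
        rw [e1, e2, finsum_insertions_self_cons F hc hd (hxy.trans hx) hy, pairWeight,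
          if_pos hxy, mul_assoc (geomInv c * d), ← ih, ← mul_assoc c, ← mul_assoc c, e3]
        noncomm_ring
    · have ih := finsum_insertions F hc hd k v (fun z hz => hv z (by simp [hz])) hs.1
      rw [finsum_insertions_cons F hf hx]
      simp only [h, not_false_iff, and_true, Set.ofPred_mem_eq]
      rw [finsum_insertions_self_cons F hc hd hx h, pairWeight_cons _ _ h,
        mul_assoc (c + geomInv c * d), ← ih,
        add_mul, ← mul_finsum_mem_of_finite _ c
          (F.finite_inter_support hf (insertions_subset k v))]
      congr 1
      exact finsum_mem_congr rfl fun w hw =>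
        pairWeight_cons c d (not_startsDescent_cons_of_mem_insertions hx h hw)

/-- The simsun words with letters less than `k`. -/
def simsunWords (k : ℕ) : Set (List ℕ) := {w | IsSimsunWord w ∧ ∀ x ∈ w, x < k}

/-- Words are grouped by what remains after deletion of the letter k. The induction must allow
arbitrary weights, since each insertion replaces c and d. -/
theorem finsum_simsunWords (F : NilFiltration B) {c d : B} (hc : c ∈ F.J 1) (hd : d ∈ F.J 2)
    (k : ℕ) : ∑ᶠ w ∈ simsunWords k, pairWeight c d w = insertionSeries k c d := by
  induction k generalizing c d with
  | zero =>
    have : simsunWords 0 = {[]} := by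
      ext w
      cases w with
      | nil => simp [simsunWords, IsSimsunWord]
      | cons x w =>
        simp only [simsunWords, Set.mem_ofPred_eq, List.forall_mem_cons, Nat.not_lt_zero,
          false_and, and_false, Set.mem_singleton_iff, reduceCtorEq]
    rw [this, finsum_mem_singleton]
    rfl
  | succ k ih =>
    have hd' : geomInv c * d ∈ F.J 2 := F.mul_mem_left _ hd
    have hc' : c + geomInv c * d ∈ F.J 1 := add_mem hc (F.anti one_le_two hd')
    rw [finsum_mem_fiberwise (t := simsunWords k) _ (fun w => w.filter (· < k))
      (F.finite_inter_support (pairWeight_mem F hc hd) (L := simsunWords (k + 1)) fun w hw => hw.2),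
      insertionSeries, ← ih hc' hd',
      ← finsum_mem_mul_of_finite _ _
        (F.finite_inter_support (pairWeight_mem F hc' hd') (L := simsunWords k) fun w hw => hw.2)]
    · refine finsum_mem_congr rfl fun v hv => ?_
      rw [← finsum_insertions F hc hd k v hv.2 hv.1]
      refine finsum_mem_congr ?_ fun _ _ => rfl
      ext w
      simp only [simsunWords, insertions, Set.mem_ofPred_eq, Nat.lt_succ_iff]
      constructor
      · rintro ⟨⟨h1, h2⟩, h3⟩
        exact ⟨h2, h3, ((isSimsunWord_iff_filter h2).1 h1).2⟩
      · rintro ⟨h2, h3, h4⟩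
        exact ⟨⟨(isSimsunWord_iff_filter h2).2 ⟨h3 ▸ hv.1, h4⟩, h2⟩, h3⟩
    · intro w hw
      refine ⟨((isSimsunWord_iff_filter fun x hx => Nat.lt_succ_iff.1 (hw.2 x hx)).1 hw.1).1, ?_⟩
      exact fun x hx => by simpa using (List.mem_filter.1 hx).2

/-! ### Simsun words that end in a maximum -/

/-- The simsun words whose last letter is a greatest one. -/
def IsSimsunMaxWord (w : List ℕ) : Prop :=
  IsSimsunWord w ∧ ∀ u M, w = u ++ [M] → ∀ x ∈ u, x ≤ M

theorem isSimsunWord_append_singleton {u : List ℕ} {M : ℕ} (h : ∀ x ∈ u, x ≤ M) :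
    IsSimsunWord (u ++ [M]) ↔ IsSimsunWord u := by
  induction u with
  | nil => simp [IsSimsunWord, StartsDescent]
  | cons x u ih =>
    rw [List.cons_append, IsSimsunWord, IsSimsunWord, ih fun y hy => h y (by simp [hy]),
      List.filter_append]
    simp [(h x (by simp)).not_gt]

theorem isSimsunMaxWord_append_singleton {u : List ℕ} {M : ℕ} :
    IsSimsunMaxWord (u ++ [M]) ↔ IsSimsunWord u ∧ ∀ x ∈ u, x ≤ M := by
  constructor
  · rintro ⟨h1, h2⟩
    have := h2 u M rfl
    exact ⟨(isSimsunWord_append_singleton this).1 h1, this⟩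
  · rintro ⟨h1, h2⟩
    refine ⟨(isSimsunWord_append_singleton h2).2 h1, fun u' M' h => ?_⟩
    obtain ⟨rfl, hM⟩ := List.append_inj' h rfl
    exact List.singleton_injective hM ▸ h2

/-- The words are sorted by their last letter. What precedes a last letter k is any simsun word with
letters at most k, and the last letter completes no descent, whence the factor a. -/
theorem wordSum_simsunMax (F : NilFiltration B) {a b : B} (ha : a ∈ F.J 1) (hb : b ∈ F.J 1)
    (k : ℕ) : wordSum a b {w | w ≠ [] ∧ IsSimsunMaxWord w ∧ ∀ x ∈ w, x < k} =
      (∑ i ∈ Finset.range k, insertionSeries (i + 1) a (a * b)) * a := by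
  induction k with
  | zero =>
    have : {w | w ≠ [] ∧ IsSimsunMaxWord w ∧ ∀ x ∈ w, x < 0} = ∅ := by
      ext w
      simp only [Set.mem_ofPred_eq, Set.mem_empty_iff_false, iff_false]
      rintro ⟨h, -, h'⟩
      obtain ⟨x, hx⟩ := List.exists_mem_of_ne_nil w h
      exact Nat.not_lt_zero _ (h' x hx)
    rw [this]
    simp [wordSum]
  | succ k ih =>
    have hset : {w | w ≠ [] ∧ IsSimsunMaxWord w ∧ ∀ x ∈ w, x < k + 1} =
        {w | w ≠ [] ∧ IsSimsunMaxWord w ∧ ∀ x ∈ w, x < k} ∪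
          (fun u => u ++ [k]) '' simsunWords (k + 1) := by
      ext w
      rcases List.eq_nil_or_concat w with rfl | ⟨u, M, rfl⟩
      · simp
      · simp only [Set.mem_union, Set.mem_ofPred_eq, Set.mem_image, List.concat_eq_append,
          isSimsunMaxWord_append_singleton, simsunWords, List.forall_mem_append,
          List.mem_singleton, forall_eq]
        constructor
        · rintro ⟨h0, ⟨h1, h2⟩, h3, h4⟩
          rcases (Nat.lt_succ_iff.1 h4).eq_or_lt with rfl | h
          · exact .inr ⟨u, ⟨h1, h3⟩, rfl⟩
          · exact .inl ⟨h0, ⟨h1, h2⟩, fun x hx => (h2 x hx).trans_lt h, h⟩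
        · rintro (⟨h0, h1, h2, h3⟩ | ⟨u', ⟨h1, h2⟩, h⟩)
          · exact ⟨h0, h1, fun x hx => (h2 x hx).trans k.lt_succ_self, h3.trans k.lt_succ_self⟩
          · obtain ⟨rfl, hM⟩ := List.append_inj' h rfl
            obtain rfl := List.singleton_injective hM
            exact ⟨by simp, ⟨h1, fun x hx => Nat.lt_succ_iff.1 (h2 x hx)⟩, h2, k.lt_succ_self⟩
    have hlast : wordSum a b ((fun u => u ++ [k]) '' simsunWords (k + 1)) =
        insertionSeries (k + 1) a (a * b) * a := by
      rw [← finsum_simsunWords F ha (F.mul_mem ha hb), wordSum,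
        finsum_mem_image (List.append_left_injective _).injOn,
        ← finsum_mem_mul_of_finite _ _ (F.finite_inter_support
          (pairWeight_mem F ha (F.mul_mem ha hb)) (L := simsunWords (k + 1)) fun w hw => hw.2)]
      refine finsum_mem_congr rfl fun u hu => ?_
      rw [stepWeight_append, stepWeight_eq_pairWeight a b u hu.1, stepWeight, stepWeight, mul_one,
        if_neg]
      rcases List.eq_nil_or_concat u with rfl | ⟨u, M, rfl⟩
      · simp
      · simpa using Nat.lt_succ_iff.1 (hu.2 M (by simp))
    rw [Finset.sum_range_succ, add_mul, ← ih, ← hlast, hset]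
    refine wordSum_union F ha hb (k := k + 1)
      (fun w hw x hx => (hw.2.2 x hx).trans k.lt_succ_self) ?_ ?_
    · rintro _ ⟨u, hu, rfl⟩ x hx
      simp only [List.mem_append, List.mem_singleton] at hx
      rcases hx with hx | rfl
      exacts [hu.2 x hx, x.lt_succ_self]
    · rw [Set.disjoint_left]
      rintro _ ⟨-, -, hw⟩ ⟨u, -, rfl⟩
      exact lt_irrefl k (hw k (by simp))

end

/-! ### Order invariance and simsun permutations -/

theorem StartsDescent.map_snd {p : List (ℕ × ℕ)}
    (hp : p.Pairwise fun x y => x.1 ≤ y.1 ↔ x.2 ≤ y.2) :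
    StartsDescent (p.map Prod.fst) ↔ StartsDescent (p.map Prod.snd) := by
  rcases p with - | ⟨x, - | ⟨y, p⟩⟩
  · simp [StartsDescent]
  · simp [StartsDescent]
  · simp only [List.pairwise_cons, List.mem_cons, forall_eq_or_imp] at hp
    simp only [List.map_cons, StartsDescent, ← not_le, hp.1.1]

theorem IsSimsunWord.map_snd {p : List (ℕ × ℕ)}
    (hp : p.Pairwise fun x y => x.1 ≤ y.1 ↔ x.2 ≤ y.2) :
    IsSimsunWord (p.map Prod.fst) ↔ IsSimsunWord (p.map Prod.snd) := by
  induction p with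
  | nil => rfl
  | cons x p ih =>
    rw [List.pairwise_cons] at hp
    rw [List.map_cons, List.map_cons, IsSimsunWord, IsSimsunWord, ih hp.2, List.filter_map,
      List.filter_map]
    have : p.filter ((fun y => decide (y < x.1)) ∘ Prod.fst) =
        p.filter ((fun y => decide (y < x.2)) ∘ Prod.snd) :=
      List.filter_congr fun y hy => by
        simp only [Function.comp_apply, ← not_le, hp.1 y hy]
    rw [this, StartsDescent.map_snd (hp.2.filter _)]

theorem IsSimsunMaxWord.map_snd {p : List (ℕ × ℕ)}
    (hp : p.Pairwise fun x y => x.1 ≤ y.1 ↔ x.2 ≤ y.2) :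
    IsSimsunMaxWord (p.map Prod.fst) ↔ IsSimsunMaxWord (p.map Prod.snd) := by
  rcases List.eq_nil_or_concat p with rfl | ⟨p, q, rfl⟩
  · simp
  · rw [List.concat_eq_append] at hp ⊢
    rw [List.pairwise_append] at hp
    simp only [List.map_append, List.map_cons, List.map_nil, isSimsunMaxWord_append_singleton,
      List.forall_mem_map]
    exact and_congr (IsSimsunWord.map_snd hp.1)
      (forall₂_congr fun x hx => hp.2.2 x hx q (by simp))

theorem noDoubleDescent_cons {x : ℕ} {v : List ℕ} : NoDoubleDescent (x :: v) ↔
    NoDoubleDescent v ∧ ¬ (StartsDescent (x :: v) ∧ StartsDescent v) := by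
  constructor
  · intro h
    refine ⟨fun i hi => ?_, ?_⟩
    · simpa using h (i + 1) (by rw [List.length_cons]; omega)
    · rintro ⟨h1, h2⟩
      rcases v with - | ⟨y, - | ⟨z, v⟩⟩
      · exact h1
      · exact h2
      · exact h 0 (by simp) ⟨h1, h2⟩
  · rintro ⟨h1, h2⟩ i hi
    cases i with
    | zero =>
      rcases v with - | ⟨y, - | ⟨z, v⟩⟩
      · simp at hi
      · simp at hi
      · exact h2
    | succ i => simpa using h1 i (by rw [List.length_cons] at hi; omega)

/-- If x > y > z are consecutive among the letters at most k, then y and z are the first letters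
below x to the right of x. Conversely, a bad letter x starts a double descent among the letters at
most x; distinctness ensures that no second x intervenes. -/
theorem isSimsunWord_iff_noDoubleDescent {w : List ℕ} {n : ℕ} (hw : w.Nodup)
    (hn : ∀ x ∈ w, x ≤ n) :
    IsSimsunWord w ↔ ∀ k ≤ n, NoDoubleDescent (w.filter (· ≤ k)) := by
  induction w with
  | nil => simp [IsSimsunWord, NoDoubleDescent]
  | cons x v ih =>
    rw [List.nodup_cons] at hw
    rw [IsSimsunWord, ih hw.2 fun y hy => hn y (by simp [hy])]
    constructor
    · rintro ⟨h1, h2⟩ k hk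
      by_cases hx : x ≤ k
      · rw [List.filter_cons_of_pos (by simpa using hx), noDoubleDescent_cons]
        refine ⟨h1 k hk, ?_⟩
        have : v.filter (· < x) = (v.filter (· ≤ k)).filter (· < x) := by
          rw [List.filter_filter]
          refine List.filter_congr fun y _ => ?_
          by_cases hy : y < x
          · simp [hy, (hy.trans_le hx).le]
          · simp [hy]
        rw [this] at h2
        generalize v.filter (· ≤ k) = u at h2
        rintro ⟨h3, h4⟩
        rcases u with - | ⟨y, - | ⟨z, u⟩⟩
        · exact h3
        · exact h4
        · have hyx : y < x := h3
          have hzy : z < y := h4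
          rw [List.filter_cons_of_pos (by simpa using hyx),
            List.filter_cons_of_pos (by simpa using hzy.trans hyx)] at h2
          exact h2 hzy
      · rw [List.filter_cons_of_neg (by simpa using hx)]
        exact h1 k hk
    · intro h
      refine ⟨fun k hk => ?_, fun hsd => ?_⟩
      · have := h k hk
        by_cases hx : x ≤ k
        · rw [List.filter_cons_of_pos (by simpa using hx), noDoubleDescent_cons] at this
          exact this.1
        · rwa [List.filter_cons_of_neg (by simpa using hx)] at this
      · have hf : v.filter (· ≤ x) = v.filter (· < x) := by
          refine List.filter_congr fun y hy => ?_
          have : y ≠ x := by rintro rfl; exact hw.1 hy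
          simp [le_iff_lt_or_eq, this]
        have := h x (hn x (by simp))
        rw [List.filter_cons_of_pos (by simp), noDoubleDescent_cons, hf] at this
        refine this.2 ⟨?_, hsd⟩
        generalize hu : v.filter (· < x) = u at hsd
        rcases u with - | ⟨y, u⟩
        · exact hsd
        · have : y ∈ v.filter (· < x) := by simp [hu]
          have hyx : y < x := by simpa using (List.mem_filter.1 this).2
          exact hyx

theorem permWord_nodup {n : ℕ} (σ : Equiv.Perm (Fin n)) : (permWord σ).Nodup := by
  rw [permWord, List.nodup_ofFn]
  intro i j h
  exact σ.injective (Fin.ext (by simpa using h))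

theorem mem_permWord {n : ℕ} (σ : Equiv.Perm (Fin n)) (x : ℕ) :
    x ∈ permWord σ ↔ 1 ≤ x ∧ x ≤ n := by
  rw [permWord, List.mem_ofFn]
  constructor
  · rintro ⟨i, rfl⟩
    exact ⟨by omega, (σ i).isLt⟩
  · rintro ⟨h1, h2⟩
    refine ⟨σ.symm ⟨x - 1, by omega⟩, ?_⟩
    simp only [Equiv.apply_symm_apply]
    omega

theorem isSimsun_iff {n : ℕ} (σ : Equiv.Perm (Fin n)) :
    IsSimsun σ ↔ IsSimsunMaxWord (permWord σ) := by
  rw [IsSimsun, IsSimsunMaxWord, and_comm, ← isSimsunWord_iff_noDoubleDescent (permWord_nodup σ)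
    fun x hx => ((mem_permWord σ x).1 hx).2]
  refine and_congr_right fun _ => ?_
  constructor
  · intro h u M hu x hx
    have hne : permWord σ ≠ [] := by simp [hu]
    have := h hne
    simp only [hu, List.getLast_append_singleton] at this
    rw [this]
    exact ((mem_permWord σ x).1 (by simp [hu, hx])).2
  · intro h hne
    have hd := (List.dropLast_append_getLast hne).symm
    have hl := (mem_permWord σ _).1 (List.getLast_mem hne)
    refine le_antisymm hl.2 ?_
    have hn : n ∈ permWord σ := (mem_permWord σ n).2 ⟨hl.1.trans hl.2, le_rfl⟩
    rw [hd, List.mem_append, List.mem_singleton] at hn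
    rcases hn with hn | hn
    · exact h _ _ hd n hn
    · exact hn.le

/-! ### Descent sets read off from triangular matrices -/

theorem prod_descentSet_cons_cons {M : Type*} [CommMonoid M] (f : ℕ → M) (x y : ℕ) (v : List ℕ) :
    ∏ l ∈ descentSet (x :: y :: v), f l =
      (if y < x then f 1 else 1) * ∏ l ∈ descentSet (y :: v), f (l + 1) := by
  rw [descentSet, descentSet, Finset.prod_filter, Finset.prod_filter,
    Finset.prod_Ico_eq_prod_range, Finset.prod_Ico_eq_prod_range, mul_comm]
  simp only [List.length_cons, Nat.add_sub_cancel]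
  rw [Finset.prod_range_succ']
  refine congrArg₂ _ (Finset.prod_congr rfl fun i _ => ?_) (by simp)
  rw [show 1 + (i + 1) - 1 = i + 1 by omega, show 1 + (i + 1) = i + 1 + 1 by omega,
    show 1 + i - 1 = i by omega, show 1 + i = i + 1 by omega]
  simp

section

variable {C : Type*} [CommRing C]

/-- The ring of upper triangular matrices. -/
def upperTriangular (C : Type*) [CommRing C] (n : ℕ) : Subring (Matrix (Fin n) (Fin n) C) where
  carrier := {M | ∀ i j : Fin n, (j : ℕ) < i → M i j = 0}
  zero_mem' := by simp
  one_mem' := fun i j h => Matrix.one_apply_ne (by rintro rfl; exact lt_irrefl _ h)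
  add_mem' := fun hM hN i j h => by simp [hM i j h, hN i j h]
  neg_mem' := fun hM i j h => by simp [hM i j h]
  mul_mem' := by
    intro M N hM hN i j h
    rw [Matrix.mul_apply]
    refine Finset.sum_eq_zero fun e _ => ?_
    by_cases he : (e : ℕ) < i
    · rw [hM i e he, zero_mul]
    · rw [hN e j (by omega), mul_zero]

/-- The filtration of the ring of upper triangular matrices by the matrices which vanish below
the successive upper diagonals. -/
def superdiagonalFiltration (C : Type*) [CommRing C] (n : ℕ) :
    NilFiltration (upperTriangular C n) where
  J m :=
    { carrier := {M | ∀ i j : Fin n, (j : ℕ) < i + m → M.1 i j = 0}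
      zero_mem' := by simp
      add_mem' := fun hM hN i j h => by simp [hM i j h, hN i j h]
      neg_mem' := fun hM i j h => by simp [hM i j h] }
  mem_zero M := M.2
  mul_mem := by
    intro m l M N hM hN i j h
    rw [Subring.coe_mul, Matrix.mul_apply]
    refine Finset.sum_eq_zero fun e _ => ?_
    by_cases he : (e : ℕ) < i + m
    · rw [hM i e he, zero_mul]
    · rw [hN e j (by omega), mul_zero]
  anti := fun m l hml M hM i j h => hM i j (by omega)
  len := n
  eq_zero M hM := by
    ext i j
    exact hM i j (by omega)

/-- The matrix with entries `ω i` on the first upper diagonal. -/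
def superdiagonal (n : ℕ) (ω : ℕ → C) : upperTriangular C n :=
  ⟨Matrix.of fun i j => if (j : ℕ) = i + 1 then ω i else 0, fun i j h => by
    rw [Matrix.of_apply, if_neg (by omega)]⟩

theorem superdiagonal_mem (n : ℕ) (ω : ℕ → C) :
    superdiagonal n ω ∈ (superdiagonalFiltration C n).J 1 := by
  intro i j h
  simp [superdiagonal, h.ne]

/-- Each letter moves from one row to the next, so the row index records the position: the l-th
letter of w leaves row i + l - 1. Descents have l ≥ 1, so the subtraction is exact. -/
theorem stepWeight_superdiagonal (n : ℕ) (ω : ℕ → C) (p : ℕ) (w : List ℕ) (i j : Fin n) :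
    (stepWeight (superdiagonal n fun _ => 1) (superdiagonal n ω) p w).1 i j =
      if (j : ℕ) = i + w.length then ∏ l ∈ descentSet (p :: w), ω (i + l - 1) else 0 := by
  induction w generalizing p i with
  | nil =>
    simp [stepWeight, descentSet, Matrix.one_apply, Fin.ext_iff, eq_comm]
  | cons x w ih =>
    have hs : (if x < p then superdiagonal n ω else superdiagonal n fun _ => 1) =
        superdiagonal n fun i => if x < p then ω i else 1 := by
      split_ifs <;> rfl
    rw [stepWeight, hs, Subring.coe_mul, Matrix.mul_apply, List.length_cons]
    by_cases hi : (i : ℕ) + 1 < n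
    · rw [Finset.sum_eq_single ⟨i + 1, hi⟩]
      · rw [ih, prod_descentSet_cons_cons]
        simp only [superdiagonal, Matrix.of_apply, if_true, Nat.add_sub_cancel]
        simp only [show ∀ l, (i : ℕ) + (l + 1) - 1 = i + 1 + l - 1 by omega, mul_ite, mul_zero,
          show (i : ℕ) + 1 + w.length = i + (w.length + 1) by omega]
      · intro e _ he
        have : (e : ℕ) ≠ i + 1 := fun h => he (Fin.ext h)
        simp [superdiagonal, this]
      · simp
    · rw [Finset.sum_eq_zero, if_neg (by omega)]
      intro e _
      have : (e : ℕ) ≠ i + 1 := by omega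
      simp [superdiagonal, this]

/-- The word of the values of a function. -/
def fnWord {n k : ℕ} (f : Fin n → Fin k) : List ℕ := List.ofFn fun i => (f i : ℕ)

open Classical in
-- Size n + 2 makes the corner entry see exactly the words of length n + 1. The letter 0 put in
-- front creates no descent and shifts positions by one, which cancels the -1 in the index of ω.
theorem wordSum_superdiagonal (P : List ℕ → Prop) (n k : ℕ) (ω : ℕ → C) :
    (wordSum (superdiagonal (n + 2) fun _ => 1) (superdiagonal (n + 2) ω)
        {w | w ≠ [] ∧ P w ∧ ∀ x ∈ w, x < k}).1 0 (Fin.last (n + 1)) =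
      ∑ f : Fin (n + 1) → Fin k with P (fnWord f), ∏ l ∈ descentSet (fnWord f), ω l := by
  have hfin : ({w | w ≠ [] ∧ P w ∧ ∀ x ∈ w, x < k} ∩ Function.support
      (stepWeight (superdiagonal (n + 2) fun _ => 1) (superdiagonal (n + 2) ω) 0)).Finite :=
    (superdiagonalFiltration C (n + 2)).finite_inter_support
      (stepWeight_mem _ (superdiagonal_mem _ _) (superdiagonal_mem _ _) 0) fun w hw => hw.2.2
  let entry : upperTriangular C (n + 2) →+ C :=
    (Matrix.entryAddMonoidHom C (0 : Fin (n + 2)) (Fin.last (n + 1))).comp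
      (upperTriangular C (n + 2)).subtype.toAddMonoidHom
  have hmap := entry.map_finsum_mem' hfin
  rw [wordSum]
  refine hmap.trans ?_
  have hinj : Function.Injective (fnWord : (Fin (n + 1) → Fin k) → List ℕ) := by
    intro f g h
    have := List.ofFn_injective h
    exact funext fun i => Fin.ext (congrFun this i)
  have himg : {w | w ≠ [] ∧ P w ∧ ∀ x ∈ w, x < k} ∩ {w | w.length = n + 1} =
      fnWord '' {f : Fin (n + 1) → Fin k | P (fnWord f)} := by
    ext w
    constructor
    · rintro ⟨⟨-, h1, h2⟩, h3⟩
      have h3 : w.length = n + 1 := h3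
      obtain ⟨f, hf⟩ : ∃ f : Fin (n + 1) → Fin k, fnWord f = w := by
        refine ⟨fun i => ⟨w[i], h2 _ (List.getElem_mem _)⟩, ?_⟩
        apply List.ext_getElem
        · simp [fnWord, h3]
        · intro i _ _
          simp only [fnWord, List.getElem_ofFn, Fin.getElem_fin]
      exact ⟨f, by rwa [← hf] at h1, hf⟩
    · rintro ⟨f, hf, rfl⟩
      refine ⟨⟨?_, hf, ?_⟩, by simp [fnWord]⟩
      · simp [fnWord]
      · simp [fnWord, List.mem_ofFn]
  have hent : ∀ w ∈ {w | w ≠ [] ∧ P w ∧ ∀ x ∈ w, x < k},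
      entry (stepWeight (superdiagonal (n + 2) fun _ => 1) (superdiagonal (n + 2) ω) 0 w) =
      if w.length = n + 1 then ∏ l ∈ descentSet w, ω l else 0 := by
    rintro w ⟨hw, -⟩
    obtain ⟨x, v, rfl⟩ := List.exists_cons_of_ne_nil hw
    change (stepWeight (superdiagonal (n + 2) fun _ => (1 : C)) (superdiagonal (n + 2) ω)
      0 (x :: v)).1 0 (Fin.last (n + 1)) = _
    rw [stepWeight_superdiagonal, prod_descentSet_cons_cons]
    simp only [Fin.val_last, Fin.val_zero, zero_add, Nat.not_lt_zero, if_false, one_mul,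
      Nat.add_sub_cancel, eq_comm]
  rw [finsum_mem_congr rfl hent, ← finsum_mem_inter_support_eq
    (fun w => if w.length = n + 1 then ∏ l ∈ descentSet w, ω l else 0)
    (fnWord '' {f : Fin (n + 1) → Fin k | P (fnWord f)}), finsum_mem_image hinj.injOn,
    finsum_mem_eq_sum_of_inter_support_eq (t := Finset.univ.filter fun f => P (fnWord f))]
  · exact Finset.sum_congr rfl fun f _ => if_pos (by simp [fnWord])
  · simp
  · rw [← himg]
    ext w
    simp
    tauto

end

/-! ### Standardization and the size of its fibres -/

theorem descentSet_map_snd {p : List (ℕ × ℕ)}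
    (hp : p.Pairwise fun x y => x.1 ≤ y.1 ↔ x.2 ≤ y.2) :
    descentSet (p.map Prod.fst) = descentSet (p.map Prod.snd) := by
  rw [descentSet, descentSet, List.length_map, List.length_map]
  refine Finset.filter_congr fun i hi => ?_
  rw [Finset.mem_Ico] at hi
  have h := List.pairwise_iff_getElem.1 hp (i - 1) i (by omega) hi.2 (by omega)
  rw [List.getD_eq_getElem _ _ (by simpa using by omega),
    List.getD_eq_getElem _ _ (by simpa using hi.2),
    List.getD_eq_getElem _ _ (by simpa using by omega),
    List.getD_eq_getElem _ _ (by simpa using hi.2)]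
  simp only [List.getElem_map, gt_iff_lt, ← not_le, h]

/-- The word of a function and the word of its standardization are order equivalent. -/
theorem exists_pairs_of_sort {n k : ℕ} (f : Fin n → Fin k) (σ : Equiv.Perm (Fin n))
    (h : Tuple.sort f = σ⁻¹) : ∃ p : List (ℕ × ℕ), p.map Prod.fst = fnWord f ∧
      p.map Prod.snd = permWord σ ∧ p.Pairwise fun x y => x.1 ≤ y.1 ↔ x.2 ≤ y.2 := by
  obtain ⟨hmono, hlt⟩ := Tuple.eq_sort_iff.1 h.symm
  refine ⟨List.ofFn fun i => ((f i : ℕ), (σ i : ℕ) + 1), ?_, ?_, ?_⟩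
  · rw [List.map_ofFn]; rfl
  · rw [List.map_ofFn]; rfl
  · rw [List.pairwise_ofFn]
    intro i j hij
    simp only [add_le_add_iff_right, Fin.val_fin_le]
    constructor
    -- An inversion of σ here would force f i = f j, and the stable sort orders equal values by
    -- position.
    · intro hf
      by_contra hσ
      have h1 := hmono (not_le.1 hσ).le
      simp only [Function.comp_apply, Equiv.Perm.coe_inv, Equiv.symm_apply_apply] at h1
      have h2 := hlt _ _ (not_le.1 hσ)
      simp only [Equiv.Perm.coe_inv, Equiv.symm_apply_apply] at h2
      exact (h2 (le_antisymm h1 hf)).not_gt hij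
    · intro hσ
      simpa using hmono hσ

/-- The number of weakly increasing sequences of length `n` with values less than `k - d`. -/
noncomputable def monotoneCount (n k d : ℕ) : ℕ :=
  Nat.card {h : Fin n → ℕ // Monotone h ∧ ∀ i, h i + d < k}

/-- Together with `monotoneCount_self_succ` this is the triangularity that separates the values of
ides. -/
theorem monotoneCount_eq_zero {n k d : ℕ} (h : k ≤ d) : monotoneCount (n + 1) k d = 0 := by
  rw [monotoneCount, Nat.card_eq_zero]
  left
  refine ⟨fun g => ?_⟩
  have := g.2.2 0
  omega

theorem monotoneCount_self_succ (n d : ℕ) : monotoneCount n (d + 1) d = 1 := by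
  rw [monotoneCount, Nat.card_eq_one_iff_unique]
  refine ⟨⟨fun g h => Subtype.ext (funext fun i => ?_)⟩,
    ⟨⟨fun _ => 0, monotone_const, by simp⟩⟩⟩
  have h1 := g.2.2 i
  have h2 := h.2.2 i
  omega

/-- The number of descents of `π` among the positions up to `i`. -/
def descentsUpTo {n : ℕ} (π : Equiv.Perm (Fin n)) (i : ℕ) : ℕ :=
  ((descentSet (permWord π)).filter (· ≤ i)).card

theorem descentsUpTo_zero {n : ℕ} (π : Equiv.Perm (Fin n)) : descentsUpTo π 0 = 0 := by
  rw [descentsUpTo, Finset.card_eq_zero, Finset.filter_eq_empty_iff]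
  intro i hi
  simp only [descentSet, Finset.mem_filter, Finset.mem_Ico] at hi
  omega

theorem descentsUpTo_last {n : ℕ} (π : Equiv.Perm (Fin (n + 1))) :
    descentsUpTo π n = des π := by
  rw [descentsUpTo, des, Finset.filter_true_of_mem]
  intro i hi
  simp only [descentSet, permWord, List.length_ofFn, Finset.mem_filter, Finset.mem_Ico] at hi
  omega

theorem descentsUpTo_le {n : ℕ} (π : Equiv.Perm (Fin n)) (i : ℕ) :
    descentsUpTo π i ≤ des π :=
  Finset.card_le_card (Finset.filter_subset _ _)

theorem descentsUpTo_succ {n : ℕ} (π : Equiv.Perm (Fin (n + 1))) (i : Fin n) :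
    descentsUpTo π (i + 1) =
      descentsUpTo π i + if π i.succ < π i.castSucc then 1 else 0 := by
  have hmem : (i + 1 : ℕ) ∈ descentSet (permWord π) ↔ π i.succ < π i.castSucc := by
    rw [descentSet, Finset.mem_filter, Finset.mem_Ico, Nat.add_sub_cancel,
      List.getD_eq_getElem _ _ (by simp [permWord]),
      List.getD_eq_getElem _ _ (by simp [permWord])]
    simp only [permWord, List.getElem_ofFn, List.length_ofFn, gt_iff_lt, add_lt_add_iff_right,
      Fin.val_fin_lt]
    exact and_iff_right ⟨by omega, by omega⟩
  rw [descentsUpTo, descentsUpTo]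
  split_ifs with h
  · rw [← Finset.card_insert_of_notMem (a := (i + 1 : ℕ)) (by simp)]
    congr 1
    ext j
    simp only [Finset.mem_filter, Finset.mem_insert, Nat.le_succ_iff]
    constructor
    · tauto
    · rintro (rfl | h')
      exacts [⟨hmem.2 h, .inr rfl⟩, ⟨h'.1, .inl h'.2⟩]
  · rw [add_zero]
    congr 1
    ext j
    simp only [Finset.mem_filter, Nat.le_succ_iff]
    constructor
    · rintro ⟨h1, h2 | rfl⟩
      exacts [⟨h1, h2⟩, absurd (hmem.1 h1) h]
    · tauto

/-- π is the stable sort of f when f ∘ π increases weakly, and strictly at the descents of π. The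
descent counts on both sides differ by one exactly at a descent, so a single inequality expresses
both cases. -/
theorem sort_eq_iff {n k : ℕ} (f : Fin (n + 1) → Fin k) (π : Equiv.Perm (Fin (n + 1))) :
    Tuple.sort f = π ↔ ∀ i : Fin n, (f (π i.castSucc) : ℕ) + descentsUpTo π (i + 1) ≤
      f (π i.succ) + descentsUpTo π i := by
  have h1 : Tuple.sort f = π ↔ StrictMono fun i => toLex (f (π i), π i) := by
    rw [eq_comm, Tuple.eq_sort_iff]
    constructor
    · rintro ⟨hm, hl⟩ i j hij
      rw [Prod.Lex.toLex_lt_toLex]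
      rcases (hm hij.le).lt_or_eq with h | h
      exacts [.inl h, .inr ⟨h, hl i j hij h⟩]
    · intro h
      refine ⟨monotone_iff_forall_lt.2 fun i j hij => ?_, fun i j hij he => ?_⟩
      · rcases Prod.Lex.toLex_lt_toLex.1 (h hij) with h | h
        exacts [h.le, h.1.le]
      · rcases Prod.Lex.toLex_lt_toLex.1 (h hij) with h | h
        exacts [absurd he h.ne, h.2]
  rw [h1, Fin.strictMono_iff_lt_succ]
  refine forall_congr' fun i => ?_
  rw [Prod.Lex.toLex_lt_toLex, descentsUpTo_succ]
  have hne : π i.castSucc ≠ π i.succ := fun h => (Fin.castSucc_lt_succ (i := i)).ne (π.injective h)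
  simp only [Fin.lt_def, Fin.ext_iff, ne_eq] at hne ⊢
  split_ifs with h <;> omega

/-- Subtracting from f (π i) the number of descents of π up to i removes the forced strict
increases. The total subtracted at the last position is `des π`, which lowers the bound k by that
amount. -/
theorem card_sort_eq {n k : ℕ} (π : Equiv.Perm (Fin (n + 1))) :
    Nat.card {f : Fin (n + 1) → Fin k // Tuple.sort f = π} =
      monotoneCount (n + 1) k (des π) := by
  -- This makes the natural-number subtraction exact, hence reversible.
  have hle : ∀ g : Fin (n + 1) → ℕ, (∀ i : Fin n, g i.castSucc + descentsUpTo π (i + 1) ≤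
      g i.succ + descentsUpTo π i) → ∀ i : Fin (n + 1), descentsUpTo π i ≤ g i := by
    intro g hg i
    induction i using Fin.induction with
    | zero => simp [descentsUpTo_zero]
    | succ i ih =>
      have := hg i
      simp only [Fin.val_castSucc, Fin.val_succ] at ih ⊢
      omega
  have hmono : ∀ g : Fin (n + 1) → ℕ, (∀ i : Fin n, g i.castSucc + descentsUpTo π (i + 1) ≤
      g i.succ + descentsUpTo π i) → Monotone fun i : Fin (n + 1) => g i - descentsUpTo π i := by
    intro g hg
    rw [Fin.monotone_iff_le_succ]
    intro i
    have h1 := hg i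
    have h2 := hle g hg i.castSucc
    have h3 := hle g hg i.succ
    simp only [Fin.val_castSucc, Fin.val_succ] at h2 h3 ⊢
    omega
  refine Nat.card_congr
    { toFun := fun f => ⟨fun i => f.1 (π i) - descentsUpTo π i, ?_, fun i => ?_⟩
      invFun := fun h => ⟨fun j => ⟨h.1 (π⁻¹ j) + descentsUpTo π (π⁻¹ j : Fin (n + 1)), ?_⟩, ?_⟩
      left_inv := fun f => ?_
      right_inv := fun h => ?_ }
  · exact hmono (fun i => f.1 (π i)) ((sort_eq_iff _ _).1 f.2)
  · have hg := (sort_eq_iff _ _).1 f.2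
    have h1 := hmono (fun i => f.1 (π i)) hg (Fin.le_last i)
    have h2 := hle (fun i => f.1 (π i)) hg (Fin.last n)
    have h3 := (f.1 (π (Fin.last n))).isLt
    simp only [Fin.val_last, descentsUpTo_last] at h1 h2 ⊢
    omega
  · have h1 := h.2.2 (π⁻¹ j)
    have h2 := descentsUpTo_le π (π⁻¹ j : Fin (n + 1))
    omega
  · rw [sort_eq_iff]
    intro i
    have := h.2.1 (Fin.castSucc_lt_succ (i := i)).le
    simp only [Equiv.Perm.coe_inv, Equiv.symm_apply_apply, Fin.val_castSucc, Fin.val_succ]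
    omega
  · refine Subtype.ext (funext fun j => Fin.ext ?_)
    have h2 := hle (fun i => f.1 (π i)) ((sort_eq_iff _ _).1 f.2) (π⁻¹ j)
    simp only [Equiv.Perm.coe_inv, Equiv.apply_symm_apply] at h2 ⊢
    omega
  · refine Subtype.ext (funext fun i => ?_)
    simp

/-! ### From words back to permutations -/

section

variable {C : Type*} [CommRing C]

open Classical in
-- Words are grouped by standardization, the inverse of the sorting permutation. P and the descent
-- set are constant on a fibre, whose size depends only on the descents of σ⁻¹.
theorem sum_fnWord_eq (P : List ℕ → Prop)
    (hP : ∀ p : List (ℕ × ℕ), p.Pairwise (fun x y => x.1 ≤ y.1 ↔ x.2 ≤ y.2) →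
      (P (p.map Prod.fst) ↔ P (p.map Prod.snd))) (n k : ℕ) (ω : ℕ → C) :
    ∑ f : Fin (n + 1) → Fin k with P (fnWord f), ∏ l ∈ descentSet (fnWord f), ω l =
      ∑ σ : Equiv.Perm (Fin (n + 1)) with P (permWord σ),
        (monotoneCount (n + 1) k (ides σ) : C) * ∏ l ∈ descentSet (permWord σ), ω l := by
  rw [Finset.sum_filter, ← Finset.sum_fiberwise (g := fun f => (Tuple.sort f)⁻¹),
    Finset.sum_filter]
  refine Finset.sum_congr rfl fun σ _ => ?_
  have hcard : (Finset.univ.filter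
      fun f : Fin (n + 1) → Fin k => (Tuple.sort f)⁻¹ = σ).card =
      monotoneCount (n + 1) k (ides σ) := by
    rw [ides, ← card_sort_eq, ← Fintype.card_subtype, Nat.card_eq_fintype_card]
    simp only [inv_eq_iff_eq_inv]
  rw [← hcard, ← nsmul_eq_mul]
  split_ifs with h
  · rw [← Finset.sum_const]
    refine Finset.sum_congr rfl fun f hf => ?_
    rw [Finset.mem_filter, inv_eq_iff_eq_inv] at hf
    obtain ⟨p, hp1, hp2, hp⟩ := exists_pairs_of_sort f σ hf.2
    rw [← hp1, ← hp2, if_pos ((hP p hp).2 (by rwa [hp2])), descentSet_map_snd hp]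
  · refine Finset.sum_eq_zero fun f hf => ?_
    rw [Finset.mem_filter, inv_eq_iff_eq_inv] at hf
    obtain ⟨p, hp1, hp2, hp⟩ := exists_pairs_of_sort f σ hf.2
    rw [← hp1, if_neg]
    rw [hP p hp, hp2]
    exact h

/-- Sums over permutations weighted by the numbers `monotoneCount` determine the sums over the
permutations with a given number of inverse descents. -/
theorem sum_filter_ides_eq {n : ℕ} (S T : Finset (Equiv.Perm (Fin (n + 1))))
    (φ : Equiv.Perm (Fin (n + 1)) → C)
    (h : ∀ k, ∑ σ ∈ S, (monotoneCount (n + 1) k (ides σ) : C) * φ σ =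
      ∑ σ ∈ T, (monotoneCount (n + 1) k (ides σ) : C) * φ σ) (d : ℕ) :
    ∑ σ ∈ S with ides σ = d, φ σ = ∑ σ ∈ T with ides σ = d, φ σ := by
  have hsplit : ∀ U : Finset (Equiv.Perm (Fin (n + 1))), ∀ k,
      ∑ σ ∈ U, (monotoneCount (n + 1) k (ides σ) : C) * φ σ =
        ∑ e ∈ Finset.range k, (monotoneCount (n + 1) k e : C) * ∑ σ ∈ U with ides σ = e, φ σ := by
    intro U k
    simp only [Finset.mul_sum, Finset.sum_filter]
    rw [Finset.sum_comm]
    refine Finset.sum_congr rfl fun σ _ => ?_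
    simp only [mul_ite, mul_zero]
    rw [Finset.sum_ite_eq]
    split_ifs with hk
    · rfl
    · rw [monotoneCount_eq_zero (by simpa using hk), Nat.cast_zero, zero_mul]
  induction d using Nat.strong_induction_on with
  | _ d ih =>
    -- At k = d + 1 the class ides = d has coefficient one, larger values do not occur, and smaller
    -- ones are known by induction.
    have := h (d + 1)
    rw [hsplit, hsplit, Finset.sum_range_succ, Finset.sum_range_succ,
      Finset.sum_congr rfl fun e he => by rw [ih e (Finset.mem_range.1 he)]] at this
    simpa [monotoneCount_self_succ] using this

end

open Classical in
-- With ω l = t q^l, the product over the descents is t^des q^maj; ides is recovered by letting k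
-- vary.
theorem genFun_eq_of_wordSum_eq (P Q : List ℕ → Prop)
    (hP : ∀ p : List (ℕ × ℕ), p.Pairwise (fun x y => x.1 ≤ y.1 ↔ x.2 ≤ y.2) →
      (P (p.map Prod.fst) ↔ P (p.map Prod.snd)))
    (hQ : ∀ p : List (ℕ × ℕ), p.Pairwise (fun x y => x.1 ≤ y.1 ↔ x.2 ≤ y.2) →
      (Q (p.map Prod.fst) ↔ Q (p.map Prod.snd)))
    (h : ∀ (n k : ℕ) (a b : upperTriangular (MvPolynomial (Fin 3) ℤ) n),
      a ∈ (superdiagonalFiltration _ n).J 1 → b ∈ (superdiagonalFiltration _ n).J 1 →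
      wordSum a b {w | w ≠ [] ∧ P w ∧ ∀ x ∈ w, x < k} =
        wordSum a b {w | w ≠ [] ∧ Q w ∧ ∀ x ∈ w, x < k}) (n : ℕ) :
    genFun (Finset.univ.filter fun σ : Equiv.Perm (Fin (n + 1)) => P (permWord σ)) =
      genFun (Finset.univ.filter fun σ : Equiv.Perm (Fin (n + 1)) => Q (permWord σ)) := by
  have hφ : ∀ σ : Equiv.Perm (Fin (n + 1)), ∏ l ∈ descentSet (permWord σ),
      (MvPolynomial.X 1 * MvPolynomial.X 2 ^ l : MvPolynomial (Fin 3) ℤ) =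
      MvPolynomial.X 1 ^ des σ * MvPolynomial.X 2 ^ maj σ := by
    intro σ
    rw [Finset.prod_mul_distrib, Finset.prod_const, Finset.prod_pow_eq_pow_sum, des, maj]
  have key := sum_filter_ides_eq
    (Finset.univ.filter fun σ : Equiv.Perm (Fin (n + 1)) => P (permWord σ))
    (Finset.univ.filter fun σ : Equiv.Perm (Fin (n + 1)) => Q (permWord σ))
    (fun σ => ∏ l ∈ descentSet (permWord σ),
      (MvPolynomial.X 1 * MvPolynomial.X 2 ^ l : MvPolynomial (Fin 3) ℤ)) fun k => by
    rw [← sum_fnWord_eq P hP, ← sum_fnWord_eq Q hQ, ← wordSum_superdiagonal,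
      ← wordSum_superdiagonal, h _ _ _ _ (superdiagonal_mem _ _) (superdiagonal_mem _ _)]
  simp only [hφ] at key
  have hgen : ∀ S : Finset (Equiv.Perm (Fin (n + 1))), genFun S =
      ∑ d ∈ Finset.univ.image (ides : Equiv.Perm (Fin (n + 1)) → ℕ), MvPolynomial.X 0 ^ d *
        ∑ σ ∈ S with ides σ = d, MvPolynomial.X 1 ^ des σ * MvPolynomial.X 2 ^ maj σ := by
    intro S
    rw [genFun, ← Finset.sum_fiberwise_of_maps_to (g := ides)
      (fun σ _ => Finset.mem_image_of_mem ides (Finset.mem_univ σ))]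
    refine Finset.sum_congr rfl fun d _ => ?_
    rw [Finset.mul_sum]
    refine Finset.sum_congr rfl fun σ hσ => ?_
    rw [(Finset.mem_filter.1 hσ).2, mul_assoc]
  rw [hgen, hgen]
  exact Finset.sum_congr rfl fun d _ => by rw [key]

theorem idesPoly_eq_aeval_genFun {n : ℕ} (S : Finset (Equiv.Perm (Fin n))) :
    idesPoly S = MvPolynomial.aeval ![Polynomial.X, 1, 1] (genFun S) := by
  simp [idesPoly, genFun]

theorem genFun_andreI_eq_genFun_andreII (n : ℕ) : genFun (andreI n) = genFun (andreII n) := by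
  classical
  cases n with
  | zero =>
    congr 1
    ext σ
    simp [andreI, andreII, permWord, IsAndreI.nil, IsAndreII.nil]
  | succ n =>
    have h1 : andreI (n + 1) = Finset.univ.filter fun σ => IsNodeWord MaxRight (permWord σ) := by
      ext σ
      simp [andreI, isAndreI_iff (permWord_nodup σ)]
    have h2 : andreII (n + 1) = Finset.univ.filter fun σ => IsNodeWord MinRight (permWord σ) := by
      ext σ
      simp [andreII, isAndreII_iff (permWord_nodup σ)]
    rw [h1, h2]
    exact genFun_eq_of_wordSum_eq _ _ (IsNodeWord.map_snd_iff maxRight_map)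
      (IsNodeWord.map_snd_iff minRight_map) (fun n k a b ha hb =>
        (wordSum_maxRight _ ha hb k).trans (wordSum_minRight _ ha hb k).symm) n

theorem genFun_andreII_eq_genFun_simsun (n : ℕ) : genFun (andreII n) = genFun (simsun n) := by
  classical
  cases n with
  | zero =>
    congr 1
    ext σ
    simp [andreII, simsun, permWord, IsAndreII.nil, IsSimsun, NoDoubleDescent]
  | succ n =>
    have h1 : andreII (n + 1) = Finset.univ.filter fun σ => IsNodeWord MinRight (permWord σ) := by
      ext σ
      simp [andreII, isAndreII_iff (permWord_nodup σ)]
    have h2 : simsun (n + 1) = Finset.univ.filter fun σ => IsSimsunMaxWord (permWord σ) := by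
      ext σ
      simp [simsun, isSimsun_iff]
    rw [h1, h2]
    exact genFun_eq_of_wordSum_eq _ _ (IsNodeWord.map_snd_iff minRight_map)
      (fun p hp => IsSimsunMaxWord.map_snd hp) (fun n k a b ha hb =>
        (wordSum_minRight _ ha hb k).trans (wordSum_simsunMax _ ha hb k).symm) n

theorem theorem1 (n : ℕ) :
    (genFun (andreI n) = genFun (andreII n) ∧ genFun (andreII n) = genFun (simsun n)) ∧
      (idesPoly (andreI n) = idesPoly (andreII n) ∧ idesPoly (andreII n) = idesPoly (simsun n)) := by
  have h1 := genFun_andreI_eq_genFun_andreII n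
  have h2 := genFun_andreII_eq_genFun_simsun n
  simp only [idesPoly_eq_aeval_genFun, h1, h2, and_self]
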